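/- Let $(M,J,\bar g)$ be an almost Hermitian manifold of real dimension $2n$ (so $J$ is an almost complex structure and $\bar g$ a Riemannian metric with $\bar g(J\cdot,J\cdot)=\bar g$), let $\bar\omega(\cdot,\cdot)=\bar g(J\cdot,\cdot)$, and let $\widetilde\nabla$ be a unitary connection on $TM$, that is, $\widetilde\nabla\bar g=0$ and $\widetilde\nabla J=0$, with torsion $\widetilde T(X,Y)=\widetilde\nabla_XY-\widetilde\nabla_YX-[X,Y]$. Let $\iota:L\to M$ be a totally real immersion of an $n$-manifold, i.e. an immersion with $J(T_pL)\cap T_pL=\{0\}$ for all $p\in L$, where $T_pL$ is identified with its image $d\iota(T_pL)\subset T_{\iota(p)}M$; then $T_{\iota(p)}M=T_pL\oplus J(T_pL)$. Write $\pi_L$ and $\pi_J$ for the projections onto $T_pL$ and $J(T_pL)$ given by this splitting, $\pi_L^t$ for the transpose of $\pi_L$ with respect to $\bar g$, $\pi_T$ for the $\bar g$-orthogonal projection onto $T_pL$, and $g=\iota^*\bar g$ for the induced metric on $L$. The Maslov form of $\iota$ is the $1$-form $\xi_J(X)=\operatorname{tr}_L(J\pi_J\widetilde\nabla_X)$ on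 $L$, the trace of the endomorphism $Y\mapsto J\pi_J\widetilde\nabla_XY$ of $T_pL$. Let $e_1,\dots,e_n$ be an orthonormal basis of $(T_pL,g)$ and define the vector fields along $L$ $$H_J=-J\big(\operatorname{tr}_L(\pi_TJ\widetilde\nabla\pi_L^t)\big)=-J\sum_i\pi_TJ\widetilde\nabla_{e_i}(\pi_L^te_i),\qquad T_J=-\sum_{i,j}\bar g\big(\pi_LJ\widetilde T(e_j,e_i),e_i\big)\,Je_j$$ (the map $(X,Y)\mapsto\pi_TJ\widetilde\nabla_X(\pi_L^tY)$ being a tensor on $T_pL$). Proposition. Let $\xi_J^\sharp$ be the vector field on $L$ corresponding to $\xi_J$ by means of the induced metric $g$. Then $$\xi_J^\sharp=JH_J+JT_J,$$ so that, for every $X$ tangent to $L$, $$\bar\omega(H_J+T_J,X)=\xi_J(X).$$ -/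

import Mathlib

open Bundle Module
open scoped Manifold ContDiff Topology

namespace TotallyReal

noncomputable section

set_option linter.unusedSectionVars false

section PullbackConnection

variable {E : Type*} [NormedAddCommGroup E] [NormedSpace ℝ E]
  {M : Type*} [TopologicalSpace M] [ChartedSpace E M] [IsManifold 𝓘(ℝ, E) ∞ M]
  {F : Type*} [NormedAddCommGroup F] [NormedSpace ℝ F]
  {L : Type*} [TopologicalSpace L] [ChartedSpace F L]

variable (E F) in
/-- A vector field `s` along the map `ι : L → M` is differentiable at `p`. -/
def DiffAlong (ι : L → M) (s : ∀ q : L, TangentSpace 𝓘(ℝ, E) (ι q)) (p : L) : Prop :=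
  MDifferentiableAt 𝓘(ℝ, F) (𝓘(ℝ, E).prod 𝓘(ℝ, E))
    (fun q ↦ (TotalSpace.mk' E (ι q) (s q) : TotalSpace E (TangentSpace 𝓘(ℝ, E) : M → Type _))) p

variable (E) in
/-- The components of a vector field along `ι` in the trivialization of `TM` centred at `ι p`. -/
def coordAlong (ι : L → M) (s : ∀ q : L, TangentSpace 𝓘(ℝ, E) (ι q)) (p q : L) : E :=
  (trivializationAt E (TangentSpace 𝓘(ℝ, E) : M → Type _) (ι p)
    (TotalSpace.mk' E (ι q) (s q))).2

variable (F) in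
/-- The pull-back by `ι : L → M` of a connection on `TM`, acting on vector fields along `ι`.
In a local frame `E_a` of `TM` near `ι p` it is
`(∇_v s)(p) = ∑ ds^a(v) E_a(ι p) + ∑ s^a(p) (∇_{dι v} E_a)(ι p)` for `s = ∑ s^a (E_a ∘ ι)`;
the frame used is the coordinate frame centred at `ι p`, and `FiberBundle.extend E (s p)` is the
field `∑ s^a(p) E_a`. -/
def pullbackCov (cov : CovariantDerivative 𝓘(ℝ, E) E (TangentSpace 𝓘(ℝ, E) : M → Type _))
    (ι : L → M) (s : ∀ q : L, TangentSpace 𝓘(ℝ, E) (ι q)) (p : L) :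
    TangentSpace 𝓘(ℝ, F) p →L[ℝ] TangentSpace 𝓘(ℝ, E) (ι p) :=
  (trivializationAt E (TangentSpace 𝓘(ℝ, E) : M → Type _) (ι p)).symmL ℝ (ι p) ∘L
      mvfderiv 𝓘(ℝ, F) (coordAlong E ι s p) p
    + cov (FiberBundle.extend E (s p)) (ι p) ∘L mfderiv 𝓘(ℝ, F) 𝓘(ℝ, E) ι p

theorem diffAlong_iff {ι : L → M} {p : L} (hι : MDifferentiableAt 𝓘(ℝ, F) 𝓘(ℝ, E) ι p)
    (s : ∀ q : L, TangentSpace 𝓘(ℝ, E) (ι q)) :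
    DiffAlong E F ι s p ↔ MDifferentiableAt 𝓘(ℝ, F) 𝓘(ℝ, E) (coordAlong E ι s p) p := by
  unfold DiffAlong
  rw [mdifferentiableAt_totalSpace]
  exact ⟨fun h ↦ h.2, fun h ↦ ⟨hι, h⟩⟩

theorem eventually_baseSet {ι : L → M} {p : L} (hι : ContinuousAt ι p) :
    ∀ᶠ q in 𝓝 p,
      ι q ∈ (trivializationAt E (TangentSpace 𝓘(ℝ, E) : M → Type _) (ι p)).baseSet :=
  hι.eventually ((trivializationAt E (TangentSpace 𝓘(ℝ, E) : M → Type _)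
    (ι p)).open_baseSet.mem_nhds (FiberBundle.mem_baseSet_trivializationAt' (ι p)))

theorem coordAlong_add {ι : L → M} {p q : L}
    (hq : ι q ∈ (trivializationAt E (TangentSpace 𝓘(ℝ, E) : M → Type _) (ι p)).baseSet)
    (s t : ∀ q : L, TangentSpace 𝓘(ℝ, E) (ι q)) :
    coordAlong E ι (fun q ↦ s q + t q) p q = coordAlong E ι s p q + coordAlong E ι t p q :=
  ((trivializationAt E (TangentSpace 𝓘(ℝ, E) : M → Type _) (ι p)).linear ℝ hq).map_add _ _

theorem coordAlong_smul {ι : L → M} {p q : L}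
    (hq : ι q ∈ (trivializationAt E (TangentSpace 𝓘(ℝ, E) : M → Type _) (ι p)).baseSet)
    (f : L → ℝ) (s : ∀ q : L, TangentSpace 𝓘(ℝ, E) (ι q)) :
    coordAlong E ι (fun q ↦ f q • s q) p q = f q • coordAlong E ι s p q :=
  ((trivializationAt E (TangentSpace 𝓘(ℝ, E) : M → Type _) (ι p)).linear ℝ hq).map_smul _ _

theorem coordAlong_eventuallyEq_add {ι : L → M} {p : L} (hι : ContinuousAt ι p)
    (s t : ∀ q : L, TangentSpace 𝓘(ℝ, E) (ι q)) :
    coordAlong E ι (fun q ↦ s q + t q) p =ᶠ[𝓝 p] coordAlong E ι s p + coordAlong E ι t p := by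
  filter_upwards [eventually_baseSet (E := E) hι] with q hq using coordAlong_add hq s t

theorem coordAlong_eventuallyEq_smul {ι : L → M} {p : L} (hι : ContinuousAt ι p)
    (f : L → ℝ) (s : ∀ q : L, TangentSpace 𝓘(ℝ, E) (ι q)) :
    coordAlong E ι (fun q ↦ f q • s q) p =ᶠ[𝓝 p] f • coordAlong E ι s p := by
  filter_upwards [eventually_baseSet (E := E) hι] with q hq using coordAlong_smul hq f s

theorem DiffAlong.add {ι : L → M} {p : L} (hι : MDifferentiableAt 𝓘(ℝ, F) 𝓘(ℝ, E) ι p)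
    {s t : ∀ q : L, TangentSpace 𝓘(ℝ, E) (ι q)} (hs : DiffAlong E F ι s p) (ht : DiffAlong E F ι t p) :
    DiffAlong E F ι (fun q ↦ s q + t q) p := by
  rw [diffAlong_iff hι] at hs ht ⊢
  exact (hs.add ht).congr_of_eventuallyEq (coordAlong_eventuallyEq_add hι.continuousAt s t)

theorem DiffAlong.smul {ι : L → M} {p : L} (hι : MDifferentiableAt 𝓘(ℝ, F) 𝓘(ℝ, E) ι p)
    {f : L → ℝ} (hf : MDifferentiableAt 𝓘(ℝ, F) 𝓘(ℝ, ℝ) f p)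
    {s : ∀ q : L, TangentSpace 𝓘(ℝ, E) (ι q)} (hs : DiffAlong E F ι s p) :
    DiffAlong E F ι (fun q ↦ f q • s q) p := by
  rw [diffAlong_iff hι] at hs ⊢
  exact (hf.smul hs).congr_of_eventuallyEq (coordAlong_eventuallyEq_smul hι.continuousAt f s)

theorem DiffAlong.congr {ι : L → M} {p : L} {s t : ∀ q : L, TangentSpace 𝓘(ℝ, E) (ι q)}
    (hs : DiffAlong E F ι s p) (h : ∀ᶠ q in 𝓝 p, t q = s q) : DiffAlong E F ι t p :=
  MDifferentiableAt.congr_of_eventuallyEq hs (by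
    filter_upwards [h] with q hq; rw [hq])

theorem mvfderiv_congr {V : Type*} [NormedAddCommGroup V] [NormedSpace ℝ V] {f g : L → V} {p : L}
    (h : f =ᶠ[𝓝 p] g) : mvfderiv 𝓘(ℝ, F) f p = mvfderiv 𝓘(ℝ, F) g p := by
  unfold mvfderiv
  rw [h.mfderiv_eq]
  ext v
  rfl

theorem mvfderiv_comp_vec {V : Type*} [NormedAddCommGroup V] [NormedSpace ℝ V] {ι : L → M}
    {g : M → V} {p : L} (hg : MDifferentiableAt 𝓘(ℝ, E) 𝓘(ℝ, V) g (ι p))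
    (hι : MDifferentiableAt 𝓘(ℝ, F) 𝓘(ℝ, E) ι p) (v : TangentSpace 𝓘(ℝ, F) p) :
    mvfderiv 𝓘(ℝ, F) (g ∘ ι) p v =
      mvfderiv 𝓘(ℝ, E) g (ι p) (mfderiv 𝓘(ℝ, F) 𝓘(ℝ, E) ι p v) := by
  simp only [mvfderiv, mfderiv_comp p hg hι]
  rfl

theorem cov_extend_add (cov : CovariantDerivative 𝓘(ℝ, E) E (TangentSpace 𝓘(ℝ, E) : M → Type _))
    {x : M} (v w : TangentSpace 𝓘(ℝ, E) x) :
    cov (FiberBundle.extend E (v + w)) x =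
      cov (FiberBundle.extend E v) x + cov (FiberBundle.extend E w) x := by
  let e := trivializationAt E (TangentSpace 𝓘(ℝ, E) : M → Type _) x
  have hx : x ∈ e.baseSet := FiberBundle.mem_baseSet_trivializationAt' x
  have h : (e ⟨x, v + w⟩).2 = (e ⟨x, v⟩).2 + (e ⟨x, w⟩).2 := (e.linear ℝ hx).map_add v w
  rw [← cov.isCovariantDerivativeOnUniv.add
    (FiberBundle.mdifferentiableAt_extend ..) (FiberBundle.mdifferentiableAt_extend ..)]
  refine cov.isCovariantDerivativeOnUniv.congr_of_eventuallyEq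
    (FiberBundle.mdifferentiableAt_extend ..)
    (mdifferentiableAt_add_section (FiberBundle.mdifferentiableAt_extend ..)
      (FiberBundle.mdifferentiableAt_extend ..)) Filter.univ_mem ?_
  filter_upwards [e.open_baseSet.mem_nhds hx] with y hy
  change e.symm y (e ⟨x, v + w⟩).2 = e.symm y (e ⟨x, v⟩).2 + e.symm y (e ⟨x, w⟩).2
  rw [h, ← e.symmₗ_apply (R := ℝ) hy, ← e.symmₗ_apply (R := ℝ) hy, ← e.symmₗ_apply (R := ℝ) hy,
    map_add]

theorem cov_extend_smul (cov : CovariantDerivative 𝓘(ℝ, E) E (TangentSpace 𝓘(ℝ, E) : M → Type _))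
    {x : M} (c : ℝ) (v : TangentSpace 𝓘(ℝ, E) x) :
    cov (FiberBundle.extend E (c • v)) x = c • cov (FiberBundle.extend E v) x := by
  let e := trivializationAt E (TangentSpace 𝓘(ℝ, E) : M → Type _) x
  have hx : x ∈ e.baseSet := FiberBundle.mem_baseSet_trivializationAt' x
  have h : (e ⟨x, c • v⟩).2 = c • (e ⟨x, v⟩).2 := (e.linear ℝ hx).map_smul c v
  rw [← cov.isCovariantDerivativeOnUniv.smul_const c (FiberBundle.mdifferentiableAt_extend ..)]
  refine cov.isCovariantDerivativeOnUniv.congr_of_eventuallyEq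
    (FiberBundle.mdifferentiableAt_extend ..)
    (MDifferentiableAt.smul_const_section (FiberBundle.mdifferentiableAt_extend ..))
    Filter.univ_mem ?_
  filter_upwards [e.open_baseSet.mem_nhds hx] with y hy
  change e.symm y (e ⟨x, c • v⟩).2 = c • e.symm y (e ⟨x, v⟩).2
  rw [h, ← e.symmₗ_apply (R := ℝ) hy, ← e.symmₗ_apply (R := ℝ) hy, map_smul]

theorem pullbackCov_add (cov : CovariantDerivative 𝓘(ℝ, E) E (TangentSpace 𝓘(ℝ, E) : M → Type _))
    {ι : L → M} {p : L} (hι : MDifferentiableAt 𝓘(ℝ, F) 𝓘(ℝ, E) ι p)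
    {s t : ∀ q : L, TangentSpace 𝓘(ℝ, E) (ι q)} (hs : DiffAlong E F ι s p) (ht : DiffAlong E F ι t p) :
    pullbackCov F cov ι (fun q ↦ s q + t q) p = pullbackCov F cov ι s p + pullbackCov F cov ι t p := by
  have hs' := (diffAlong_iff hι s).1 hs
  have ht' := (diffAlong_iff hι t).1 ht
  ext v
  simp only [pullbackCov]
  rw [mvfderiv_congr (coordAlong_eventuallyEq_add hι.continuousAt s t), mvfderiv_add hs' ht',
    cov_extend_add]
  simp
  abel

theorem pullbackCov_smul (cov : CovariantDerivative 𝓘(ℝ, E) E (TangentSpace 𝓘(ℝ, E) : M → Type _))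
    {ι : L → M} {p : L} (hι : MDifferentiableAt 𝓘(ℝ, F) 𝓘(ℝ, E) ι p)
    {f : L → ℝ} (hf : MDifferentiableAt 𝓘(ℝ, F) 𝓘(ℝ, ℝ) f p)
    {s : ∀ q : L, TangentSpace 𝓘(ℝ, E) (ι q)} (hs : DiffAlong E F ι s p)
    (v : TangentSpace 𝓘(ℝ, F) p) :
    pullbackCov F cov ι (fun q ↦ f q • s q) p v =
      f p • pullbackCov F cov ι s p v + mvfderiv 𝓘(ℝ, F) f p v • s p := by
  have hs' := (diffAlong_iff hι s).1 hs
  have hx := FiberBundle.mem_baseSet_trivializationAt' (F := E)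
    (E := (TangentSpace 𝓘(ℝ, E) : M → Type _)) (ι p)
  simp only [pullbackCov]
  rw [mvfderiv_congr (coordAlong_eventuallyEq_smul hι.continuousAt f s), mvfderiv_smul hf hs',
    cov_extend_smul]
  have h : (trivializationAt E (TangentSpace 𝓘(ℝ, E) : M → Type _) (ι p)).symmL ℝ (ι p)
      (coordAlong E ι s p p) = s p := by
    rw [Trivialization.symmL_apply _ hx]
    exact Trivialization.symm_apply_apply_mk _ hx (s p)
  simp [h]
  module

theorem extend_self {x : M} (v : TangentSpace 𝓘(ℝ, E) x) :
    (FiberBundle.extend E v : ∀ y : M, TangentSpace 𝓘(ℝ, E) y) x = v :=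
  FiberBundle.extend_apply_self (F := E) v

theorem pullbackCov_id_extend
    (cov : CovariantDerivative 𝓘(ℝ, E) E (TangentSpace 𝓘(ℝ, E) : M → Type _))
    {x : M} (v w : TangentSpace 𝓘(ℝ, E) x) :
    pullbackCov E cov (fun y : M ↦ y) (FiberBundle.extend E v) x w =
      cov (FiberBundle.extend E v) x w := by
  let e := trivializationAt E (TangentSpace 𝓘(ℝ, E) : M → Type _) x
  have hx : x ∈ e.baseSet := FiberBundle.mem_baseSet_trivializationAt' x
  have hc : coordAlong E (fun y : M ↦ y) (FiberBundle.extend E v) x =ᶠ[𝓝 x]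
      fun _ ↦ (e ⟨x, v⟩).2 := by
    filter_upwards [e.open_baseSet.mem_nhds hx] with y hy
    change (e ⟨y, e.symm y (e ⟨x, v⟩).2⟩).2 = _
    rw [e.apply_mk_symm hy]
  simp only [pullbackCov]
  rw [mvfderiv_congr hc, mvfderiv_const, extend_self, ContinuousLinearMap.comp_zero, zero_add]
  change cov _ x (mfderiv 𝓘(ℝ, E) 𝓘(ℝ, E) (id : M → M) x w) = _
  rw [mfderiv_id]
  rfl

theorem pullbackCov_id [FiniteDimensional ℝ E]
    (cov : CovariantDerivative 𝓘(ℝ, E) E (TangentSpace 𝓘(ℝ, E) : M → Type _))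
    {σ : ∀ x : M, TangentSpace 𝓘(ℝ, E) x} {x : M}
    (hσ : MDifferentiableAt 𝓘(ℝ, E) (𝓘(ℝ, E).prod 𝓘(ℝ, E)) (fun x ↦
      (TotalSpace.mk' E x (σ x) : TotalSpace E (TangentSpace 𝓘(ℝ, E) : M → Type _))) x)
    (w : TangentSpace 𝓘(ℝ, E) x) :
    pullbackCov E cov (fun y : M ↦ y) σ x w = cov σ x w := by
  have hid : MDifferentiableAt 𝓘(ℝ, E) 𝓘(ℝ, E) (fun y : M ↦ y) x := mdifferentiableAt_id
  have hT : TensorialAt 𝓘(ℝ, E) E (fun τ : ∀ y : M, TangentSpace 𝓘(ℝ, E) y ↦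
      cov τ x w - pullbackCov E cov (fun y : M ↦ y) τ x w) x := by
    constructor
    · intro f τ hf hτ
      have h1 := pullbackCov_smul cov hid hf (s := τ) hτ w
      have h2 := cov.isCovariantDerivativeOnUniv.leibniz hτ hf
      change cov (f • τ) x w - pullbackCov E cov (fun y : M ↦ y) (fun y ↦ f y • τ y) x w = _
      rw [h1, h2]
      simp
      module
    · intro τ τ' hτ hτ'
      have h1 := pullbackCov_add cov hid (s := τ) (t := τ') hτ hτ'
      have h2 := cov.isCovariantDerivativeOnUniv.add hτ hτ'
      change cov (τ + τ') x w - pullbackCov E cov (fun y : M ↦ y) (fun y ↦ τ y + τ' y) x w = _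
      rw [h1, h2]
      simp
      abel
  have h := hT.pointwise (σ' := FiberBundle.extend E (σ x)) hσ
    (FiberBundle.mdifferentiableAt_extend ..) (extend_self (σ x)).symm
  rw [pullbackCov_id_extend, sub_self, sub_eq_zero] at h
  exact h.symm

/-- The defining property of the pull-back connection: `(ι^*∇)_v (σ ∘ ι) = ∇_{dι v} σ`. -/
theorem pullbackCov_comp [FiniteDimensional ℝ E]
    (cov : CovariantDerivative 𝓘(ℝ, E) E (TangentSpace 𝓘(ℝ, E) : M → Type _))
    {ι : L → M} {p : L} (hι : MDifferentiableAt 𝓘(ℝ, F) 𝓘(ℝ, E) ι p)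
    {σ : ∀ x : M, TangentSpace 𝓘(ℝ, E) x}
    (hσ : MDifferentiableAt 𝓘(ℝ, E) (𝓘(ℝ, E).prod 𝓘(ℝ, E)) (fun x ↦
      (TotalSpace.mk' E x (σ x) : TotalSpace E (TangentSpace 𝓘(ℝ, E) : M → Type _))) (ι p))
    (v : TangentSpace 𝓘(ℝ, F) p) :
    pullbackCov F cov ι (fun q ↦ σ (ι q)) p v = cov σ (ι p) (mfderiv 𝓘(ℝ, F) 𝓘(ℝ, E) ι p v) := by
  have hid : MDifferentiableAt 𝓘(ℝ, E) 𝓘(ℝ, E) (fun y : M ↦ y) (ι p) := mdifferentiableAt_id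
  rw [← pullbackCov_id cov hσ]
  have hσ' : MDifferentiableAt 𝓘(ℝ, E) 𝓘(ℝ, E) (coordAlong E (fun y : M ↦ y) σ (ι p)) (ι p) :=
    (diffAlong_iff hid σ).1 hσ
  have h3 : mfderiv 𝓘(ℝ, E) 𝓘(ℝ, E) (fun y : M ↦ y) (ι p) =
    ContinuousLinearMap.id ℝ (TangentSpace 𝓘(ℝ, E) (ι p)) := mfderiv_id
  have hcomp : mvfderiv 𝓘(ℝ, F) (coordAlong E (fun y : M ↦ y) σ (ι p) ∘ ι) p v =
      mvfderiv 𝓘(ℝ, E) (coordAlong E (fun y : M ↦ y) σ (ι p)) (ι p)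
        (mfderiv 𝓘(ℝ, F) 𝓘(ℝ, E) ι p v) := mvfderiv_comp_vec hσ' hι v
  have h4 : coordAlong E ι (fun q ↦ σ (ι q)) p = coordAlong E (fun y : M ↦ y) σ (ι p) ∘ ι := rfl
  simp only [pullbackCov, add_apply, ContinuousLinearMap.comp_apply]
  rw [h4, hcomp, h3]
  rfl

end PullbackConnection

section Structures

variable {E : Type*} [NormedAddCommGroup E] [NormedSpace ℝ E] [FiniteDimensional ℝ E]
  {M : Type*} [TopologicalSpace M] [ChartedSpace E M] [IsManifold 𝓘(ℝ, E) ∞ M]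
  {F : Type*} [NormedAddCommGroup F] [NormedSpace ℝ F] [FiniteDimensional ℝ F]
  {L : Type*} [TopologicalSpace L] [ChartedSpace F L] [IsManifold 𝓘(ℝ, F) ∞ L]

instance (x : M) : FiniteDimensional ℝ (TangentSpace 𝓘(ℝ, E) x) :=
  inferInstanceAs (FiniteDimensional ℝ E)

variable (E M) in
/-- A smooth almost complex structure on `M`. -/
structure AlmostComplexStructure where
  /-- The endomorphism `J_x` of `T_x M`. -/
  toFun (x : M) : TangentSpace 𝓘(ℝ, E) x →L[ℝ] TangentSpace 𝓘(ℝ, E) x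
  contMDiff : ContMDiff 𝓘(ℝ, E) (𝓘(ℝ, E).prod 𝓘(ℝ, E →L[ℝ] E)) ∞
    (fun x ↦ (TotalSpace.mk' (E →L[ℝ] E) x (toFun x) : TotalSpace (E →L[ℝ] E)
      (fun x : M ↦ TangentSpace 𝓘(ℝ, E) x →L[ℝ] TangentSpace 𝓘(ℝ, E) x)))
  sq (x : M) (v : TangentSpace 𝓘(ℝ, E) x) : toFun x (toFun x v) = -v

instance : CoeFun (AlmostComplexStructure E M)
    (fun _ ↦ ∀ x : M, TangentSpace 𝓘(ℝ, E) x →L[ℝ] TangentSpace 𝓘(ℝ, E) x) :=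
  ⟨AlmostComplexStructure.toFun⟩

variable (E M) in
/-- A smooth Riemannian metric on `M`. -/
abbrev Metric := ContMDiffRiemannianMetric 𝓘(ℝ, E) ∞ E (TangentSpace 𝓘(ℝ, E) : M → Type _)

/-- `(M, J, g)` is almost Hermitian: each `J_x` is an isometry of `g_x`. -/
def IsAlmostHermitian (g : Metric E M) (J : AlmostComplexStructure E M) : Prop :=
  ∀ (x : M) (u v : TangentSpace 𝓘(ℝ, E) x), g.inner x (J x u) (J x v) = g.inner x u v

/-- The fundamental form `ω(u, v) = g(Ju, v)`. -/
def fundamentalForm (g : Metric E M) (J : AlmostComplexStructure E M) (x : M)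
    (u v : TangentSpace 𝓘(ℝ, E) x) : ℝ :=
  g.inner x (J x u) v

/-- A connection on `TM` is unitary if it preserves both `g` and `J`. -/
structure IsUnitaryConnection (g : Metric E M) (J : AlmostComplexStructure E M)
    (cov : CovariantDerivative 𝓘(ℝ, E) E (TangentSpace 𝓘(ℝ, E) : M → Type _)) : Prop where
  /-- `v · g(σ, τ) = g(∇_v σ, τ) + g(σ, ∇_v τ)`. -/
  metric (x : M) (σ τ : ∀ x : M, TangentSpace 𝓘(ℝ, E) x)
    (hσ : MDifferentiableAt 𝓘(ℝ, E) (𝓘(ℝ, E).prod 𝓘(ℝ, E)) (fun x ↦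
      (TotalSpace.mk' E x (σ x) : TotalSpace E (TangentSpace 𝓘(ℝ, E) : M → Type _))) x)
    (hτ : MDifferentiableAt 𝓘(ℝ, E) (𝓘(ℝ, E).prod 𝓘(ℝ, E)) (fun x ↦
      (TotalSpace.mk' E x (τ x) : TotalSpace E (TangentSpace 𝓘(ℝ, E) : M → Type _))) x)
    (v : TangentSpace 𝓘(ℝ, E) x) :
    mvfderiv 𝓘(ℝ, E) (fun y ↦ g.inner y (σ y) (τ y)) x v =
      g.inner x (cov σ x v) (τ x) + g.inner x (σ x) (cov τ x v)
  /-- `∇_v (J σ) = J ∇_v σ`. -/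
  complex (x : M) (σ : ∀ x : M, TangentSpace 𝓘(ℝ, E) x)
    (hσ : MDifferentiableAt 𝓘(ℝ, E) (𝓘(ℝ, E).prod 𝓘(ℝ, E)) (fun x ↦
      (TotalSpace.mk' E x (σ x) : TotalSpace E (TangentSpace 𝓘(ℝ, E) : M → Type _))) x)
    (v : TangentSpace 𝓘(ℝ, E) x) :
    cov (fun y ↦ J y (σ y)) x v = J x (cov σ x v)

variable (E F) in
/-- The tangent plane of `L` at `p`, as a subspace of `T_{ι p} M`. -/
def tangentPlane (ι : L → M) (p : L) : Submodule ℝ (TangentSpace 𝓘(ℝ, E) (ι p)) :=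
  LinearMap.range (mfderiv 𝓘(ℝ, F) 𝓘(ℝ, E) ι p).toLinearMap

variable (F) in
/-- The image `J(T_p L)` of the tangent plane, as a subspace of `T_{ι p} M`. -/
def rotatedPlane (J : AlmostComplexStructure E M) (ι : L → M) (p : L) :
    Submodule ℝ (TangentSpace 𝓘(ℝ, E) (ι p)) :=
  (tangentPlane E F ι p).map (J (ι p)).toLinearMap

variable (F) in
/-- `ι : L → M` is a totally real immersion, with `dim M = 2 dim L`. -/
structure IsTotallyReal (J : AlmostComplexStructure E M) (ι : L → M) : Prop where
  finrank_eq : finrank ℝ E = 2 * finrank ℝ F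
  contMDiff : ContMDiff 𝓘(ℝ, F) 𝓘(ℝ, E) ∞ ι
  injective_mfderiv (p : L) : Function.Injective (mfderiv 𝓘(ℝ, F) 𝓘(ℝ, E) ι p)
  disjoint (p : L) : Disjoint (tangentPlane E F ι p) (rotatedPlane F J ι p)

/-- The metric at `x`, as a bilinear form. -/
def metricForm (g : Metric E M) (x : M) : LinearMap.BilinForm ℝ (TangentSpace 𝓘(ℝ, E) x) :=
  LinearMap.mk₂ ℝ (fun u v ↦ g.inner x u v) (by simp) (by simp) (by simp) (by simp)

theorem metric_self_eq_zero (g : Metric E M) {x : M} {v : TangentSpace 𝓘(ℝ, E) x}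
    (h : g.inner x v v = 0) : v = 0 := by
  by_contra hv
  exact (g.pos x v hv).ne' h

theorem metricForm_isRefl (g : Metric E M) (x : M) : (metricForm g x).IsRefl :=
  fun u v huv ↦ (g.symm x v u).trans huv

theorem metricForm_nondegenerate (g : Metric E M) (x : M) : (metricForm g x).Nondegenerate :=
  ⟨fun v hv ↦ metric_self_eq_zero g (hv v), fun v hv ↦ metric_self_eq_zero g (hv v)⟩

theorem isCompl_orthogonal (g : Metric E M) (x : M) (W : Submodule ℝ (TangentSpace 𝓘(ℝ, E) x)) :
    IsCompl W ((metricForm g x).orthogonal W) := by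
  rw [LinearMap.BilinForm.isCompl_orthogonal_iff_disjoint (metricForm_isRefl g x),
    Submodule.disjoint_def]
  exact fun v hv hv' ↦ metric_self_eq_zero g (hv' v hv)

theorem AlmostComplexStructure.injective (J : AlmostComplexStructure E M) (x : M) :
    Function.Injective (J x) := by
  intro u v huv
  have := congrArg (J x) huv
  rwa [J.sq, J.sq, neg_inj] at this

theorem IsTotallyReal.mdifferentiableAt {J : AlmostComplexStructure E M} {ι : L → M}
    (h : IsTotallyReal F J ι) (p : L) : MDifferentiableAt 𝓘(ℝ, F) 𝓘(ℝ, E) ι p :=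
  (h.contMDiff p).mdifferentiableAt (by simp)

/-- The splitting `T_{ι p} M = T_p L ⊕ J(T_p L)`. -/
theorem IsTotallyReal.isCompl {J : AlmostComplexStructure E M} {ι : L → M}
    (h : IsTotallyReal F J ι) (p : L) :
    IsCompl (tangentPlane E F ι p) (rotatedPlane F J ι p) := by
  have h1 : finrank ℝ (tangentPlane E F ι p) = finrank ℝ F :=
    LinearMap.finrank_range_of_inj (h.injective_mfderiv p)
  have h2 : finrank ℝ (rotatedPlane F J ι p) = finrank ℝ F :=
    (LinearEquiv.finrank_eq (Submodule.equivMapOfInjective (J (ι p)).toLinearMap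
      (J.injective (ι p)) (tangentPlane E F ι p))).symm.trans h1
  refine (Submodule.isCompl_iff_disjoint _ _ ?_).2 (h.disjoint p)
  rw [h1, h2, ← two_mul, ← h.finrank_eq]
  rfl

end Structures

section Projections

variable {E : Type*} [NormedAddCommGroup E] [NormedSpace ℝ E] [FiniteDimensional ℝ E]
  {M : Type*} [TopologicalSpace M] [ChartedSpace E M] [IsManifold 𝓘(ℝ, E) ∞ M]
  {F : Type*} [NormedAddCommGroup F] [NormedSpace ℝ F] [FiniteDimensional ℝ F]
  {L : Type*} [TopologicalSpace L] [ChartedSpace F L] [IsManifold 𝓘(ℝ, F) ∞ L]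
  {J : AlmostComplexStructure E M} {ι : L → M}

/-- The projection `π_L` of `T_{ι p} M` onto `T_p L` along `J(T_p L)`. -/
def projL (h : IsTotallyReal F J ι) (p : L) :
    TangentSpace 𝓘(ℝ, E) (ι p) →ₗ[ℝ] TangentSpace 𝓘(ℝ, E) (ι p) :=
  (tangentPlane E F ι p).projection (rotatedPlane F J ι p) (h.isCompl p)

/-- The projection `π_J` of `T_{ι p} M` onto `J(T_p L)` along `T_p L`. -/
def projJ (h : IsTotallyReal F J ι) (p : L) :
    TangentSpace 𝓘(ℝ, E) (ι p) →ₗ[ℝ] TangentSpace 𝓘(ℝ, E) (ι p) :=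
  (rotatedPlane F J ι p).projection (tangentPlane E F ι p) (h.isCompl p).symm

variable (F) in
/-- The orthogonal projection `π_T` of `T_{ι p} M` onto `T_p L`. -/
def projT (g : Metric E M) (ι : L → M) (p : L) :
    TangentSpace 𝓘(ℝ, E) (ι p) →ₗ[ℝ] TangentSpace 𝓘(ℝ, E) (ι p) :=
  (tangentPlane E F ι p).projection ((metricForm g (ι p)).orthogonal (tangentPlane E F ι p))
    (isCompl_orthogonal g (ι p) _)

/-- The transpose of `π_L` with respect to the metric. -/
def projLt (g : Metric E M) (h : IsTotallyReal F J ι) (p : L) :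
    TangentSpace 𝓘(ℝ, E) (ι p) →ₗ[ℝ] TangentSpace 𝓘(ℝ, E) (ι p) :=
  (metricForm g (ι p)).leftAdjointOfNondegenerate (metricForm_nondegenerate g (ι p)) (projL h p)

/-- `g(π_L^t u, v) = g(u, π_L v)`. -/
theorem inner_projLt (g : Metric E M) (h : IsTotallyReal F J ι) (p : L)
    (u v : TangentSpace 𝓘(ℝ, E) (ι p)) :
    g.inner (ι p) (projLt g h p u) v = g.inner (ι p) u (projL h p v) :=
  (metricForm g (ι p)).isAdjointPairLeftAdjointOfNondegenerate (metricForm_nondegenerate g (ι p))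
    (projL h p) u v

theorem projL_tangent (h : IsTotallyReal F J ι) {p : L} {v : TangentSpace 𝓘(ℝ, E) (ι p)}
    (hv : v ∈ tangentPlane E F ι p) : projL h p v = v :=
  Submodule.projection_apply_of_mem_left _ hv

theorem projL_rotated (h : IsTotallyReal F J ι) {p : L} {v : TangentSpace 𝓘(ℝ, E) (ι p)}
    (hv : v ∈ rotatedPlane F J ι p) : projL h p v = 0 :=
  (Submodule.projection_apply_eq_zero_iff _).2 hv

theorem projJ_tangent (h : IsTotallyReal F J ι) {p : L} {v : TangentSpace 𝓘(ℝ, E) (ι p)}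
    (hv : v ∈ tangentPlane E F ι p) : projJ h p v = 0 :=
  (Submodule.projection_apply_eq_zero_iff _).2 hv

theorem mfderiv_mem (p : L) (v : TangentSpace 𝓘(ℝ, F) p) :
    mfderiv 𝓘(ℝ, F) 𝓘(ℝ, E) ι p v ∈ tangentPlane E F ι p :=
  ⟨v, rfl⟩

theorem J_mem {p : L} {v : TangentSpace 𝓘(ℝ, E) (ι p)} (hv : v ∈ tangentPlane E F ι p) :
    J (ι p) v ∈ rotatedPlane F J ι p :=
  ⟨v, hv, rfl⟩

theorem J_projJ_mem (h : IsTotallyReal F J ι) (p : L) (v : TangentSpace 𝓘(ℝ, E) (ι p)) :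
    J (ι p) (projJ h p v) ∈ tangentPlane E F ι p := by
  obtain ⟨w, hw, hw'⟩ : projJ h p v ∈ rotatedPlane F J ι p :=
    Submodule.projection_apply_mem _ _
  rw [← hw']
  change J (ι p) (J (ι p) w) ∈ _
  rw [J.sq]
  exact Submodule.neg_mem _ hw

theorem projT_J_projLt (g : Metric E M) (hg : IsAlmostHermitian g J) (h : IsTotallyReal F J ι)
    (p : L) (v : TangentSpace 𝓘(ℝ, E) (ι p)) :
    projT F g ι p (J (ι p) (projLt g h p v)) = 0 := by
  refine (Submodule.projection_apply_eq_zero_iff _).2 fun w hw ↦ ?_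
  change g.inner (ι p) w (J (ι p) (projLt g h p v)) = 0
  rw [← hg, J.sq, map_neg, g.symm, inner_projLt, projL_rotated h (J_mem hw)]
  simp

end Projections

section Differentiability

variable {E : Type*} [NormedAddCommGroup E] [NormedSpace ℝ E] [FiniteDimensional ℝ E]
  {M : Type*} [TopologicalSpace M] [ChartedSpace E M] [IsManifold 𝓘(ℝ, E) ∞ M]
  {F : Type*} [NormedAddCommGroup F] [NormedSpace ℝ F] [FiniteDimensional ℝ F]
  {L : Type*} [TopologicalSpace L] [ChartedSpace F L] [IsManifold 𝓘(ℝ, F) ∞ L]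
  {J : AlmostComplexStructure E M} {ι : L → M}

variable (F) in
/-- The vector field `Y` on `L` is differentiable at `p`. -/
def DiffField (Y : ∀ q : L, TangentSpace 𝓘(ℝ, F) q) (p : L) : Prop :=
  MDifferentiableAt 𝓘(ℝ, F) (𝓘(ℝ, F).prod 𝓘(ℝ, F)) (fun q ↦
    (TotalSpace.mk' F q (Y q) : TotalSpace F (TangentSpace 𝓘(ℝ, F) : L → Type _))) p

variable (E) in
/-- The vector field `dι(Y)` along `ι`. -/
def pushField (ι : L → M) (Y : ∀ q : L, TangentSpace 𝓘(ℝ, F) q) (q : L) :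
    TangentSpace 𝓘(ℝ, E) (ι q) :=
  mfderiv 𝓘(ℝ, F) 𝓘(ℝ, E) ι q (Y q)

theorem diffAlong_pushField (h : IsTotallyReal F J ι) {p : L}
    {Y : ∀ q : L, TangentSpace 𝓘(ℝ, F) q} (hY : DiffField F Y p) :
    DiffAlong E F ι (pushField E ι Y) p := by
  have h1 : ContMDiff 𝓘(ℝ, F).tangent 𝓘(ℝ, E).tangent 1 (tangentMap 𝓘(ℝ, F) 𝓘(ℝ, E) ι) :=
    h.contMDiff.contMDiff_tangentMap (WithTop.coe_le_coe.2 (show (1 + 1 : ℕ∞) ≤ ⊤ from le_top))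
  exact ((h1 ⟨p, Y p⟩).mdifferentiableAt one_ne_zero).comp p hY

theorem DiffAlong.rotate {p : L} (hι : MDifferentiableAt 𝓘(ℝ, F) 𝓘(ℝ, E) ι p)
    {s : ∀ q : L, TangentSpace 𝓘(ℝ, E) (ι q)} (hs : DiffAlong E F ι s p) :
    DiffAlong E F ι (fun q ↦ J (ι q) (s q)) p := by
  have hJ := ((J.contMDiff (ι p)).mdifferentiableAt (by simp)).comp p hι
  exact MDifferentiableAt.clm_bundle_apply (b := ι) (ϕ := fun q ↦ J (ι q)) (v := s) hJ hs

theorem DiffAlong.inner (g : Metric E M) {p : L} (hι : MDifferentiableAt 𝓘(ℝ, F) 𝓘(ℝ, E) ι p)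
    {s t : ∀ q : L, TangentSpace 𝓘(ℝ, E) (ι q)}
    (hs : DiffAlong E F ι s p) (ht : DiffAlong E F ι t p) :
    MDifferentiableAt 𝓘(ℝ, F) 𝓘(ℝ, ℝ) (fun q ↦ g.inner (ι q) (s q) (t q)) p := by
  have hg := ((g.contMDiff (ι p)).mdifferentiableAt (by simp)).comp p hι
  have : MDifferentiableAt 𝓘(ℝ, F) (𝓘(ℝ, E).prod 𝓘(ℝ)) (fun q ↦
      TotalSpace.mk' ℝ (E := Bundle.Trivial M ℝ) (ι q) (g.inner (ι q) (s q) (t q))) p := by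
    apply MDifferentiableAt.clm_bundle_apply₂ (F₁ := E) (F₂ := E)
    · exact hg
    · exact hs
    · exact ht
  simp only [mdifferentiableAt_totalSpace] at this
  exact this.2

theorem DiffAlong.sum {κ : Type*} [Fintype κ] {p : L}
    (hι : MDifferentiableAt 𝓘(ℝ, F) 𝓘(ℝ, E) ι p)
    {s : κ → ∀ q : L, TangentSpace 𝓘(ℝ, E) (ι q)} (hs : ∀ k, DiffAlong E F ι (s k) p)
    {c : κ → L → ℝ} (hc : ∀ k, MDifferentiableAt 𝓘(ℝ, F) 𝓘(ℝ, ℝ) (c k) p) :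
    DiffAlong E F ι (fun q ↦ ∑ k, c k q • s k q) p := by
  classical
  have key : ∀ S : Finset κ, S.Nonempty → DiffAlong E F ι (fun q ↦ ∑ k ∈ S, c k q • s k q) p := by
    intro S hS
    induction hS using Finset.Nonempty.cons_induction with
    | singleton a => simpa using (hs a).smul hι (hc a)
    | cons a S ha hS ih =>
      simp only [Finset.sum_cons]
      exact ((hs a).smul hι (hc a)).add hι ih
  rcases isEmpty_or_nonempty κ with hκ | hκ
  · rw [diffAlong_iff hι]
    have h0 : coordAlong E ι (fun q ↦ ∑ k, c k q • s k q) p =ᶠ[𝓝 p] fun _ ↦ 0 := by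
      filter_upwards [eventually_baseSet (E := E) hι.continuousAt] with q hq
      simpa using coordAlong_smul hq (fun _ ↦ 0) (fun q ↦ ∑ k, c k q • s k q)
    exact mdifferentiableAt_const.congr_of_eventuallyEq h0
  · exact key _ Finset.univ_nonempty

theorem mdifferentiableAt_pi {κ V : Type*} [Fintype κ] [NormedAddCommGroup V] [NormedSpace ℝ V]
    {f : L → κ → V} {p : L}
    (hf : ∀ k, MDifferentiableAt 𝓘(ℝ, F) 𝓘(ℝ, V) (fun q ↦ f q k) p) :
    MDifferentiableAt 𝓘(ℝ, F) 𝓘(ℝ, κ → V) f p := by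
  rw [mdifferentiableAt_iff]
  exact ⟨continuousAt_pi.2 fun k ↦ (hf k).continuousAt, differentiableWithinAt_pi.2 fun k ↦
    ((mdifferentiableAt_iff ..).1 (hf k)).2⟩

/-- The coefficients solving `∑ c_k A_{kl} = r_l`. -/
def cramerCoeff {κ : Type*} [Fintype κ] [DecidableEq κ] (A : κ → κ → ℝ) (r : κ → ℝ) (k : κ) : ℝ :=
  (Matrix.of A).det⁻¹ * ((Matrix.of A).updateRow k r).det

theorem differentiableAt_det {κ V : Type*} [Fintype κ] [DecidableEq κ] [NormedAddCommGroup V]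
    [NormedSpace ℝ V] {A : V → Matrix κ κ ℝ} {x : V}
    (hA : ∀ k l, DifferentiableAt ℝ (fun y ↦ A y k l) x) :
    DifferentiableAt ℝ (fun y ↦ (A y).det) x := by
  simp only [Matrix.det_apply']
  fun_prop

theorem cramerCoeff_differentiableAt {κ : Type*} [Fintype κ] [DecidableEq κ] (k : κ)
    {A : κ → κ → ℝ} (r : κ → ℝ) (hA : (Matrix.of A).det ≠ 0) :
    DifferentiableAt ℝ (fun x : (κ → κ → ℝ) × (κ → ℝ) ↦ cramerCoeff x.1 x.2 k) (A, r) := by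
  unfold cramerCoeff
  refine DifferentiableAt.mul (DifferentiableAt.inv (differentiableAt_det fun i j ↦ ?_) hA)
    (differentiableAt_det fun i j ↦ ?_)
  · simp only [Matrix.of_apply]
    fun_prop
  · by_cases hi : i = k
    · subst hi
      simp only [Matrix.updateRow_self]
      fun_prop
    · simp only [Matrix.updateRow_ne hi, Matrix.of_apply]
      fun_prop

theorem cramerCoeff_sum {κ : Type*} [Fintype κ] [DecidableEq κ] {A : κ → κ → ℝ} (r : κ → ℝ)
    (hA : (Matrix.of A).det ≠ 0) (l : κ) : ∑ k, cramerCoeff A r k * A k l = r l := by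
  have h := congrFun (Matrix.mulVec_cramer (Matrix.of A).transpose r) l
  rw [Matrix.mulVec, Matrix.det_transpose] at h
  simp only [dotProduct, Matrix.transpose_apply, Matrix.of_apply, Matrix.cramer_transpose_apply,
    Pi.smul_apply, smul_eq_mul] at h
  simp only [cramerCoeff, mul_assoc, ← Finset.mul_sum]
  rw [Finset.sum_congr rfl fun k _ ↦ mul_comm _ (A k l), h]
  exact inv_mul_cancel_left₀ hA _

/-- A vector field along `ι` is differentiable if its inner products with a differentiable frame
are. -/
theorem diffAlong_of_inner (g : Metric E M) {κ : Type*} [Fintype κ] [DecidableEq κ] {p : L}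
    (hι : MDifferentiableAt 𝓘(ℝ, F) 𝓘(ℝ, E) ι p)
    (hκ : Fintype.card κ = finrank ℝ E) {v : κ → ∀ q : L, TangentSpace 𝓘(ℝ, E) (ι q)}
    (hv : ∀ k, DiffAlong E F ι (v k) p)
    (hspan : ⊤ ≤ Submodule.span ℝ (Set.range fun k ↦ v k p))
    {s : ∀ q : L, TangentSpace 𝓘(ℝ, E) (ι q)}
    (hs : ∀ k, MDifferentiableAt 𝓘(ℝ, F) 𝓘(ℝ, ℝ) (fun q ↦ g.inner (ι q) (s q) (v k q)) p) :
    DiffAlong E F ι s p := by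
  let A : L → κ → κ → ℝ := fun q k l ↦ g.inner (ι q) (v k q) (v l q)
  let r : L → κ → ℝ := fun q k ↦ g.inner (ι q) (s q) (v k q)
  have hAd : MDifferentiableAt 𝓘(ℝ, F) 𝓘(ℝ, κ → κ → ℝ) A p :=
    mdifferentiableAt_pi fun k ↦ mdifferentiableAt_pi fun l ↦
      (hv k).inner g hι (hv l)
  have hrd : MDifferentiableAt 𝓘(ℝ, F) 𝓘(ℝ, κ → ℝ) r p := mdifferentiableAt_pi hs
  have hli : LinearIndependent ℝ fun k ↦ v k p :=
    linearIndependent_of_top_le_span_of_card_eq_finrank hspan hκ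
  have hA0 : (Matrix.of (A p)).det ≠ 0 := by
    intro h0
    obtain ⟨x, hx, hx0⟩ := Matrix.exists_vecMul_eq_zero_iff.2 h0
    refine hx (funext fun k ↦ (Fintype.linearIndependent_iff.1 hli) x ?_ k)
    refine metric_self_eq_zero g (x := ι p) ?_
    have h1 : ∀ l, g.inner (ι p) (∑ k, x k • v k p) (v l p) = 0 := by
      intro l
      have := congrFun hx0 l
      simpa [Matrix.vecMul, dotProduct, A] using this
    rw [map_sum (g.inner (ι p) (∑ k, x k • v k p))]
    exact Finset.sum_eq_zero fun l _ ↦ by rw [map_smul, h1, smul_zero]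
  have hdet : ∀ᶠ q in 𝓝 p, (Matrix.of (A q)).det ≠ 0 := by
    have : ContinuousAt (fun q ↦ (Matrix.of (A q)).det) p :=
      ContinuousAt.comp (g := fun B : κ → κ → ℝ ↦ (Matrix.of B).det)
        (Continuous.continuousAt (Continuous.matrix_det (by
          exact continuous_id))) hAd.continuousAt
    exact this.eventually_ne hA0
  refine (DiffAlong.sum hι hv (c := fun k q ↦ cramerCoeff (A q) (r q) k) fun k ↦ ?_).congr ?_
  · exact (cramerCoeff_differentiableAt k (r p) hA0).comp_mdifferentiableAt (f := fun q ↦ (A q, r q))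
      (hAd.prodMk_space hrd)
  · filter_upwards [hdet] with q hq
    have hliq : LinearIndependent ℝ fun k ↦ v k q := by
      refine Fintype.linearIndependent_iff.2 fun x hx ↦ ?_
      refine congrFun (Matrix.eq_zero_of_vecMul_eq_zero hq (funext fun l ↦ ?_))
      have := congrArg (fun w ↦ g.inner (ι q) w (v l q)) hx
      simpa [Matrix.vecMul, dotProduct, A] using this
    have hsq : Submodule.span ℝ (Set.range fun k ↦ v k q) = ⊤ :=
      hliq.span_eq_top_of_card_eq_finrank' hκ
    rw [← sub_eq_zero]
    refine metric_self_eq_zero g (x := ι q) ?_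
    have h1 : ∀ l, g.inner (ι q) (s q - ∑ k, cramerCoeff (A q) (r q) k • v k q) (v l q) = 0 := by
      intro l
      have := cramerCoeff_sum (r q) hq l
      rw [map_sub, map_sum]
      simp only [map_smul, sub_apply, sum_apply, smul_apply, smul_eq_mul]
      rw [sub_eq_zero]
      exact this.symm
    have h2 : ∀ w ∈ Submodule.span ℝ (Set.range fun k ↦ v k q),
        g.inner (ι q) (s q - ∑ k, cramerCoeff (A q) (r q) k • v k q) w = 0 := by
      intro w hw
      induction hw using Submodule.span_induction with
      | mem w hw => obtain ⟨l, rfl⟩ := hw; exact h1 l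
      | zero => exact map_zero _
      | add a b _ _ ha hb => rw [map_add, ha, hb, add_zero]
      | smul c a _ ha => rw [map_smul, ha, smul_zero]
    exact h2 _ (hsq ▸ Submodule.mem_top)

/-- `π_L^t(dι(Y))` is a differentiable vector field along `ι` if `Y` is differentiable. -/
theorem diffAlong_projLt (g : Metric E M) (h : IsTotallyReal F J ι) {p : L}
    {Y : ∀ q : L, TangentSpace 𝓘(ℝ, F) q} (hY : DiffField F Y p) :
    DiffAlong E F ι (fun q ↦ projLt g h q (pushField E ι Y q)) p := by
  have hι := h.mdifferentiableAt p
  let b : Basis (Fin (finrank ℝ F)) ℝ (TangentSpace 𝓘(ℝ, F) p) := finBasis ℝ F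
  let Z : Fin (finrank ℝ F) → ∀ q : L, TangentSpace 𝓘(ℝ, F) q := fun i ↦ FiberBundle.extend F (b i)
  have hZ : ∀ i, DiffField F (Z i) p := fun i ↦ FiberBundle.mdifferentiableAt_extend ..
  have hZp : ∀ i, Z i p = b i := fun i ↦ FiberBundle.extend_apply_self (F := F) (b i)
  let v : Fin (finrank ℝ F) ⊕ Fin (finrank ℝ F) → ∀ q : L, TangentSpace 𝓘(ℝ, E) (ι q) :=
    Sum.elim (fun i ↦ pushField E ι (Z i)) (fun i q ↦ J (ι q) (pushField E ι (Z i) q))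
  have hv : ∀ k, DiffAlong E F ι (v k) p := by
    rintro (i | i)
    · exact diffAlong_pushField h (hZ i)
    · exact (diffAlong_pushField h (hZ i)).rotate hι
  have hT : tangentPlane E F ι p ≤ Submodule.span ℝ (Set.range fun i ↦ v (Sum.inl i) p) := by
    rintro _ ⟨w, rfl⟩
    rw [← b.sum_repr w, map_sum]
    refine Submodule.sum_mem _ fun i _ ↦ ?_
    rw [map_smul]
    refine Submodule.smul_mem _ _ (Submodule.subset_span ⟨i, ?_⟩)
    change mfderiv 𝓘(ℝ, F) 𝓘(ℝ, E) ι p (Z i p) = _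
    rw [hZp]
    rfl
  have hR : rotatedPlane F J ι p ≤ Submodule.span ℝ (Set.range fun i ↦ v (Sum.inr i) p) := by
    refine (Submodule.map_mono hT).trans ?_
    rw [Submodule.map_span, ← Set.range_comp]
    exact le_rfl
  have hspan : ⊤ ≤ Submodule.span ℝ (Set.range fun k ↦ v k p) := by
    rw [← (h.isCompl p).sup_eq_top]
    refine sup_le (hT.trans (Submodule.span_mono ?_)) (hR.trans (Submodule.span_mono ?_))
    · rintro _ ⟨i, rfl⟩; exact ⟨_, rfl⟩
    · rintro _ ⟨i, rfl⟩; exact ⟨_, rfl⟩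
  refine diffAlong_of_inner g hι (by simp [h.finrank_eq, two_mul]) hv hspan ?_
  rintro (i | i)
  · simp only [inner_projLt]
    have : ∀ q, projL h q (v (Sum.inl i) q) = pushField E ι (Z i) q := fun q ↦
      projL_tangent h (mfderiv_mem q _)
    simp only [this]
    exact (diffAlong_pushField h hY).inner g hι (diffAlong_pushField h (hZ i))
  · simp only [inner_projLt]
    have : ∀ q, projL h q (v (Sum.inr i) q) = 0 := fun q ↦
      projL_rotated h (J_mem (mfderiv_mem q _))
    simp only [this, map_zero]
    exact mdifferentiableAt_const

end Differentiability

section Definitions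

variable {E : Type*} [NormedAddCommGroup E] [NormedSpace ℝ E] [FiniteDimensional ℝ E]
  {M : Type*} [TopologicalSpace M] [ChartedSpace E M] [IsManifold 𝓘(ℝ, E) ∞ M]
  {F : Type*} [NormedAddCommGroup F] [NormedSpace ℝ F] [FiniteDimensional ℝ F]
  {L : Type*} [TopologicalSpace L] [ChartedSpace F L] [IsManifold 𝓘(ℝ, F) ∞ L]
  {J : AlmostComplexStructure E M} {ι : L → M}

theorem pullbackCov_pushField_add
    (cov : CovariantDerivative 𝓘(ℝ, E) E (TangentSpace 𝓘(ℝ, E) : M → Type _))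
    (h : IsTotallyReal F J ι) {p : L} {Y Z : ∀ q : L, TangentSpace 𝓘(ℝ, F) q}
    (hY : DiffField F Y p) (hZ : DiffField F Z p) :
    pullbackCov F cov ι (pushField E ι (Y + Z)) p =
      pullbackCov F cov ι (pushField E ι Y) p + pullbackCov F cov ι (pushField E ι Z) p := by
  rw [← pullbackCov_add cov (h.mdifferentiableAt p) (diffAlong_pushField h hY)
    (diffAlong_pushField h hZ)]
  congr 1
  funext q
  exact map_add _ _ _

theorem pullbackCov_pushField_smul
    (cov : CovariantDerivative 𝓘(ℝ, E) E (TangentSpace 𝓘(ℝ, E) : M → Type _))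
    (h : IsTotallyReal F J ι) {p : L} {f : L → ℝ} {Y : ∀ q : L, TangentSpace 𝓘(ℝ, F) q}
    (hf : MDifferentiableAt 𝓘(ℝ, F) 𝓘(ℝ, ℝ) f p) (hY : DiffField F Y p)
    (v : TangentSpace 𝓘(ℝ, F) p) :
    pullbackCov F cov ι (pushField E ι (f • Y)) p v =
      f p • pullbackCov F cov ι (pushField E ι Y) p v
        + mvfderiv 𝓘(ℝ, F) f p v • pushField E ι Y p := by
  rw [← pullbackCov_smul cov (h.mdifferentiableAt p) hf (diffAlong_pushField h hY)]
  congr 2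
  funext q
  exact map_smul _ _ _

theorem pullbackCov_projLt_add (g : Metric E M)
    (cov : CovariantDerivative 𝓘(ℝ, E) E (TangentSpace 𝓘(ℝ, E) : M → Type _))
    (h : IsTotallyReal F J ι) {p : L} {Y Z : ∀ q : L, TangentSpace 𝓘(ℝ, F) q}
    (hY : DiffField F Y p) (hZ : DiffField F Z p) :
    pullbackCov F cov ι (fun q ↦ projLt g h q (pushField E ι (Y + Z) q)) p =
      pullbackCov F cov ι (fun q ↦ projLt g h q (pushField E ι Y q)) p
        + pullbackCov F cov ι (fun q ↦ projLt g h q (pushField E ι Z q)) p := by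
  rw [← pullbackCov_add cov (h.mdifferentiableAt p) (diffAlong_projLt g h hY)
    (diffAlong_projLt g h hZ)]
  congr 1
  funext q
  rw [← map_add]
  congr 1
  exact map_add _ _ _

theorem pullbackCov_projLt_smul (g : Metric E M)
    (cov : CovariantDerivative 𝓘(ℝ, E) E (TangentSpace 𝓘(ℝ, E) : M → Type _))
    (h : IsTotallyReal F J ι) {p : L} {f : L → ℝ} {Y : ∀ q : L, TangentSpace 𝓘(ℝ, F) q}
    (hf : MDifferentiableAt 𝓘(ℝ, F) 𝓘(ℝ, ℝ) f p) (hY : DiffField F Y p)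
    (v : TangentSpace 𝓘(ℝ, F) p) :
    pullbackCov F cov ι (fun q ↦ projLt g h q (pushField E ι (f • Y) q)) p v =
      f p • pullbackCov F cov ι (fun q ↦ projLt g h q (pushField E ι Y q)) p v
        + mvfderiv 𝓘(ℝ, F) f p v • projLt g h p (pushField E ι Y p) := by
  rw [← pullbackCov_smul cov (h.mdifferentiableAt p) hf (diffAlong_projLt g h hY)]
  congr 2
  funext q
  rw [← map_smul]
  congr 1
  exact map_smul _ _ _

/-- The tensor `(X, Y) ↦ J π_J ∇_X Y` on `L`, with values in `T_{ι p} M`; here `Y` is extended to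
a vector field on `L`. -/
def maslovTensor (cov : CovariantDerivative 𝓘(ℝ, E) E (TangentSpace 𝓘(ℝ, E) : M → Type _))
    (h : IsTotallyReal F J ι) (p : L) :
    TangentSpace 𝓘(ℝ, F) p →L[ℝ] TangentSpace 𝓘(ℝ, F) p →L[ℝ] TangentSpace 𝓘(ℝ, E) (ι p) :=
  TensorialAt.mkHom₂ (I := 𝓘(ℝ, F)) (F := F) (F' := F)
    (V := (TangentSpace 𝓘(ℝ, F) : L → Type _)) (V' := (TangentSpace 𝓘(ℝ, F) : L → Type _))
    (fun X Y ↦ J (ι p) (projJ h p (pullbackCov F cov ι (pushField E ι Y) p (X p)))) p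
    (fun Y _ ↦ ⟨fun _ _ ↦ by simp, fun _ _ ↦ by simp⟩)
    (fun X _ ↦ ⟨fun {f Y} hf hY ↦ by
        rw [pullbackCov_pushField_smul cov h hf hY, map_add, map_smul, map_smul,
          projJ_tangent h (v := pushField E ι Y p) (mfderiv_mem p (Y p))]
        simp,
      fun hY hZ ↦ by
        rw [pullbackCov_pushField_add cov h hY hZ]
        simp⟩)

/-- The tensor `(X, Y) ↦ π_T J ∇_X (π_L^t Y)` on `L`, with values in `T_{ι p} M`; here `Y` is
extended to a vector field on `L`. -/
def meanTensor (g : Metric E M) (hg : IsAlmostHermitian g J)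
    (cov : CovariantDerivative 𝓘(ℝ, E) E (TangentSpace 𝓘(ℝ, E) : M → Type _))
    (h : IsTotallyReal F J ι) (p : L) :
    TangentSpace 𝓘(ℝ, F) p →L[ℝ] TangentSpace 𝓘(ℝ, F) p →L[ℝ] TangentSpace 𝓘(ℝ, E) (ι p) :=
  TensorialAt.mkHom₂ (I := 𝓘(ℝ, F)) (F := F) (F' := F)
    (V := (TangentSpace 𝓘(ℝ, F) : L → Type _)) (V' := (TangentSpace 𝓘(ℝ, F) : L → Type _))
    (fun X Y ↦ projT F g ι p (J (ι p)
      (pullbackCov F cov ι (fun q ↦ projLt g h q (pushField E ι Y q)) p (X p)))) p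
    (fun Y _ ↦ ⟨fun _ _ ↦ by simp, fun _ _ ↦ by simp⟩)
    (fun X _ ↦ ⟨fun {f Y} hf hY ↦ by
        rw [pullbackCov_projLt_smul g cov h hf hY, map_add, map_add, map_smul, map_smul, map_smul,
          map_smul, projT_J_projLt g hg h, smul_zero, add_zero],
      fun hY hZ ↦ by
        rw [pullbackCov_projLt_add g cov h hY hZ]
        simp⟩)

theorem maslovTensor_apply
    (cov : CovariantDerivative 𝓘(ℝ, E) E (TangentSpace 𝓘(ℝ, E) : M → Type _))
    (h : IsTotallyReal F J ι) (p : L) (v : TangentSpace 𝓘(ℝ, F) p)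
    {Y : ∀ q : L, TangentSpace 𝓘(ℝ, F) q} (hY : DiffField F Y p) :
    maslovTensor cov h p v (Y p) =
      J (ι p) (projJ h p (pullbackCov F cov ι (pushField E ι Y) p v)) := by
  have hX : DiffField F (FiberBundle.extend F v) p := FiberBundle.mdifferentiableAt_extend ..
  conv => rw [← extend_self v]
  exact TensorialAt.mkHom₂_apply (I := 𝓘(ℝ, F)) (F := F) (F' := F)
    (V := (TangentSpace 𝓘(ℝ, F) : L → Type _)) (V' := (TangentSpace 𝓘(ℝ, F) : L → Type _)) _ _
    hX hY

theorem meanTensor_apply (g : Metric E M) (hg : IsAlmostHermitian g J)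
    (cov : CovariantDerivative 𝓘(ℝ, E) E (TangentSpace 𝓘(ℝ, E) : M → Type _))
    (h : IsTotallyReal F J ι) (p : L) (v : TangentSpace 𝓘(ℝ, F) p)
    {Y : ∀ q : L, TangentSpace 𝓘(ℝ, F) q} (hY : DiffField F Y p) :
    meanTensor g hg cov h p v (Y p) = projT F g ι p (J (ι p)
      (pullbackCov F cov ι (fun q ↦ projLt g h q (pushField E ι Y q)) p v)) := by
  have hX : DiffField F (FiberBundle.extend F v) p := FiberBundle.mdifferentiableAt_extend ..
  conv => rw [← extend_self v]
  exact TensorialAt.mkHom₂_apply (I := 𝓘(ℝ, F)) (F := F) (F' := F)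
    (V := (TangentSpace 𝓘(ℝ, F) : L → Type _)) (V' := (TangentSpace 𝓘(ℝ, F) : L → Type _)) _ _
    hX hY

/-- The identification `dι : T_p L ≃ dι(T_p L)`. -/
def tangentEquiv (h : IsTotallyReal F J ι) (p : L) :
    TangentSpace 𝓘(ℝ, F) p ≃ₗ[ℝ] tangentPlane E F ι p :=
  LinearEquiv.ofInjective (mfderiv 𝓘(ℝ, F) 𝓘(ℝ, E) ι p).toLinearMap (h.injective_mfderiv p)

theorem maslovTensor_mem
    (cov : CovariantDerivative 𝓘(ℝ, E) E (TangentSpace 𝓘(ℝ, E) : M → Type _))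
    (h : IsTotallyReal F J ι) (p : L) (v w : TangentSpace 𝓘(ℝ, F) p) :
    maslovTensor cov h p v w ∈ tangentPlane E F ι p := by
  rw [maslovTensor, TensorialAt.mkHom₂_apply_eq_extend]
  exact J_projJ_mem h p _

/-- The endomorphism `Y ↦ J π_J ∇_X Y` of `T_p L`. -/
def maslovEndomorphism (cov : CovariantDerivative 𝓘(ℝ, E) E (TangentSpace 𝓘(ℝ, E) : M → Type _))
    (h : IsTotallyReal F J ι) (p : L) (X : TangentSpace 𝓘(ℝ, F) p) :
    TangentSpace 𝓘(ℝ, F) p →ₗ[ℝ] TangentSpace 𝓘(ℝ, F) p :=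
  (tangentEquiv h p).symm.toLinearMap ∘ₗ
    (maslovTensor cov h p X).toLinearMap.codRestrict (tangentPlane E F ι p)
      (maslovTensor_mem cov h p X)

/-- The Maslov form `ξ_J(X) = tr_L(J π_J ∇_X)`. -/
def maslovForm (cov : CovariantDerivative 𝓘(ℝ, E) E (TangentSpace 𝓘(ℝ, E) : M → Type _))
    (h : IsTotallyReal F J ι) (p : L) : Dual ℝ (TangentSpace 𝓘(ℝ, F) p) where
  toFun X := LinearMap.trace ℝ _ (maslovEndomorphism cov h p X)
  map_add' X Y := by
    rw [← map_add]
    congr 1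
    ext Z
    apply (tangentEquiv h p).injective
    ext
    simp [maslovEndomorphism]
  map_smul' c X := by
    rw [RingHom.id_apply, ← map_smul]
    congr 1
    ext Z
    apply (tangentEquiv h p).injective
    ext
    simp [maslovEndomorphism]

variable (F) in
/-- The induced metric `ι^* g` on `T_p L`. -/
def inducedForm (g : Metric E M) (ι : L → M) (p : L) :
    LinearMap.BilinForm ℝ (TangentSpace 𝓘(ℝ, F) p) :=
  (metricForm g (ι p)).compl₁₂ (mfderiv 𝓘(ℝ, F) 𝓘(ℝ, E) ι p).toLinearMap
    (mfderiv 𝓘(ℝ, F) 𝓘(ℝ, E) ι p).toLinearMap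

theorem inducedForm_apply (g : Metric E M) (ι : L → M) (p : L) (v w : TangentSpace 𝓘(ℝ, F) p) :
    inducedForm F g ι p v w = g.inner (ι p) (mfderiv 𝓘(ℝ, F) 𝓘(ℝ, E) ι p v)
      (mfderiv 𝓘(ℝ, F) 𝓘(ℝ, E) ι p w) :=
  rfl

theorem inducedForm_pos (g : Metric E M) (h : IsTotallyReal F J ι) (p : L)
    {v : TangentSpace 𝓘(ℝ, F) p} (hv : v ≠ 0) : 0 < inducedForm F g ι p v v :=
  g.pos _ _ fun h0 ↦ hv (h.injective_mfderiv p (h0.trans (map_zero _).symm))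

theorem inducedForm_symm (g : Metric E M) (ι : L → M) (p : L) (v w : TangentSpace 𝓘(ℝ, F) p) :
    inducedForm F g ι p v w = inducedForm F g ι p w v :=
  g.symm _ _ _

theorem inducedForm_nondegenerate (g : Metric E M) (h : IsTotallyReal F J ι) (p : L) :
    (inducedForm F g ι p).Nondegenerate := by
  constructor
  · intro v hv
    by_contra h0
    exact (inducedForm_pos g h p h0).ne' (hv v)
  · intro v hv
    by_contra h0
    exact (inducedForm_pos g h p h0).ne' (hv v)

/-- The vector `α^♯` dual to the covector `α` on `T_p L` with respect to the induced metric. -/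
def sharp (g : Metric E M) (h : IsTotallyReal F J ι) (p : L)
    (α : Dual ℝ (TangentSpace 𝓘(ℝ, F) p)) : TangentSpace 𝓘(ℝ, F) p :=
  ((inducedForm F g ι p).toDual (inducedForm_nondegenerate g h p)).symm α

theorem inducedForm_sharp (g : Metric E M) (h : IsTotallyReal F J ι) (p : L)
    (α : Dual ℝ (TangentSpace 𝓘(ℝ, F) p)) (v : TangentSpace 𝓘(ℝ, F) p) :
    inducedForm F g ι p (sharp g h p α) v = α v :=
  LinearMap.BilinForm.apply_toDual_symm_apply ..

/-- A basis of `T_p L` is orthonormal for the induced metric. -/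
def IsOrthonormal (g : Metric E M) (ι : L → M) (p : L)
    (e : Basis (Fin (finrank ℝ F)) ℝ (TangentSpace 𝓘(ℝ, F) p)) : Prop :=
  ∀ i j, inducedForm F g ι p (e i) (e j) = if i = j then 1 else 0

theorem exists_isOrthonormal (g : Metric E M) (h : IsTotallyReal F J ι) (p : L) :
    ∃ e : Basis (Fin (finrank ℝ F)) ℝ (TangentSpace 𝓘(ℝ, F) p), IsOrthonormal g ι p e := by
  obtain ⟨v, hv⟩ : ∃ v : Basis (Fin (finrank ℝ F)) ℝ (TangentSpace 𝓘(ℝ, F) p),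
      (inducedForm F g ι p).IsOrthoᵢ v :=
    LinearMap.BilinForm.exists_orthogonal_basis (B := inducedForm F g ι p)
      ⟨inducedForm_symm g ι p⟩
  have hpos : ∀ i, 0 < inducedForm F g ι p (v i) (v i) := fun i ↦
    inducedForm_pos g h p (v.ne_zero i)
  refine ⟨v.isUnitSMul (w := fun i ↦ (√(inducedForm F g ι p (v i) (v i)))⁻¹) fun i ↦
    (inv_ne_zero (Real.sqrt_ne_zero'.2 (hpos i))).isUnit, fun i j ↦ ?_⟩
  rw [Basis.isUnitSMul_apply, Basis.isUnitSMul_apply]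
  simp only [map_smul, LinearMap.smul_apply, smul_eq_mul]
  split_ifs with hij
  · subst hij
    rw [← mul_assoc, ← mul_inv, Real.mul_self_sqrt (hpos i).le, inv_mul_cancel₀ (hpos i).ne']
  · have : inducedForm F g ι p (v i) (v j) = 0 := hv hij
    rw [this, mul_zero, mul_zero]

/-- An orthonormal basis of `T_p L`. -/
def orthonormalBasis (g : Metric E M) (h : IsTotallyReal F J ι) (p : L) :
    Basis (Fin (finrank ℝ F)) ℝ (TangentSpace 𝓘(ℝ, F) p) :=
  (exists_isOrthonormal g h p).choose

/-- The metric trace `tr_L β = ∑ β(e_i, e_i)` of a bilinear map on `T_p L`. -/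
def metricTrace (g : Metric E M) (h : IsTotallyReal F J ι) (p : L)
    {W : Type*} [AddCommGroup W] [Module ℝ W]
    (β : TangentSpace 𝓘(ℝ, F) p →ₗ[ℝ] TangentSpace 𝓘(ℝ, F) p →ₗ[ℝ] W) : W :=
  ∑ i, β (orthonormalBasis g h p i) (orthonormalBasis g h p i)

theorem IsOrthonormal.sum_smul {g : Metric E M} {ι : L → M} {p : L}
    {e : Basis (Fin (finrank ℝ F)) ℝ (TangentSpace 𝓘(ℝ, F) p)} (he : IsOrthonormal g ι p e)
    (v : TangentSpace 𝓘(ℝ, F) p) : ∑ i, inducedForm F g ι p v (e i) • e i = v := by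
  conv_rhs => rw [← e.sum_repr v]
  refine Finset.sum_congr rfl fun i _ ↦ ?_
  congr 1
  conv_lhs => rw [← e.sum_repr v]
  simp only [map_sum, map_smul, LinearMap.sum_apply, LinearMap.smul_apply, smul_eq_mul, he _ _]
  simp

/-- The metric trace does not depend on the orthonormal basis. -/
theorem metricTrace_eq {g : Metric E M} (h : IsTotallyReal F J ι) {p : L}
    {W : Type*} [AddCommGroup W] [Module ℝ W]
    (β : TangentSpace 𝓘(ℝ, F) p →ₗ[ℝ] TangentSpace 𝓘(ℝ, F) p →ₗ[ℝ] W)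
    {e : Basis (Fin (finrank ℝ F)) ℝ (TangentSpace 𝓘(ℝ, F) p)} (he : IsOrthonormal g ι p e) :
    metricTrace g h p β = ∑ i, β (e i) (e i) := by
  set f := orthonormalBasis g h p with hf
  have hfo : IsOrthonormal g ι p f := (exists_isOrthonormal g h p).choose_spec
  have h1 : ∀ i, β (f i) (f i) = ∑ k, ∑ l,
      (inducedForm F g ι p (f i) (e k) * inducedForm F g ι p (f i) (e l)) • β (e k) (e l) := by
    intro i
    conv_lhs => rw [← he.sum_smul (f i)]
    simp only [map_sum, map_smul, LinearMap.sum_apply, LinearMap.smul_apply, Finset.smul_sum,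
      smul_smul]
    rw [Finset.sum_comm]
    exact Finset.sum_congr rfl fun k _ ↦ Finset.sum_congr rfl fun l _ ↦ by rw [mul_comm]
  have h2 : ∀ k l, ∑ i, inducedForm F g ι p (f i) (e k) * inducedForm F g ι p (f i) (e l) =
      if k = l then 1 else 0 := by
    intro k l
    rw [← he k l]
    conv_rhs => rw [← hfo.sum_smul (e k)]
    simp only [map_sum, map_smul, LinearMap.sum_apply, LinearMap.smul_apply, smul_eq_mul]
    exact Finset.sum_congr rfl fun i _ ↦ by rw [inducedForm_symm g ι p (e k) (f i)]
  unfold metricTrace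
  simp only [← hf, h1]
  rw [Finset.sum_comm]
  refine Finset.sum_congr rfl fun k _ ↦ ?_
  rw [Finset.sum_comm]
  simp only [← Finset.sum_smul, h2]
  simp

/-- The vector field `H_J = -J(tr_L(π_T J ∇ π_L^t))`. -/
def meanCurvatureJ (g : Metric E M) (hg : IsAlmostHermitian g J)
    (cov : CovariantDerivative 𝓘(ℝ, E) E (TangentSpace 𝓘(ℝ, E) : M → Type _))
    (h : IsTotallyReal F J ι) (p : L) : TangentSpace 𝓘(ℝ, E) (ι p) :=
  -J (ι p) (metricTrace g h p (meanTensor g hg cov h p).toLinearMap₁₂)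

/-- An orthonormal basis of `dι(T_p L)`. -/
def orthonormalFrame (g : Metric E M) (h : IsTotallyReal F J ι) (p : L) (i : Fin (finrank ℝ F)) :
    TangentSpace 𝓘(ℝ, E) (ι p) :=
  mfderiv 𝓘(ℝ, F) 𝓘(ℝ, E) ι p (orthonormalBasis g h p i)

/-- The vector field `T_J = -∑_{i,j} g(π_L J T(e_j, e_i), e_i) J e_j`, with `e_i` an orthonormal
basis of `T_p L` and `T(X, Y) = ∇_X Y - ∇_Y X - [X, Y]` the torsion of the connection. -/
def torsionVectorJ (g : Metric E M)
    (cov : CovariantDerivative 𝓘(ℝ, E) E (TangentSpace 𝓘(ℝ, E) : M → Type _))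
    (h : IsTotallyReal F J ι) (p : L) : TangentSpace 𝓘(ℝ, E) (ι p) :=
  -∑ i, ∑ j, g.inner (ι p)
      (projL h p (J (ι p)
        (cov.torsion (ι p) (orthonormalFrame g h p j) (orthonormalFrame g h p i))))
      (orthonormalFrame g h p i) • J (ι p) (orthonormalFrame g h p j)

end Definitions

end

end TotallyReal

/-! Write `B(X, Y) = J π_J ∇_X Y` for the Maslov tensor. Since `J` interchanges `TL` and `J(TL)`,
also `B(X, Y) = π_L J ∇_X Y` (`J_projJ`). The Maslov form is the trace of `B` in its second slot:
`ξ_J(x) = ∑ g(B(x, e_i), e_i)`. The proof compares it with the sum obtained by interchanging the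
arguments of `B`, namely `∑ g(B(e_i, x), e_i)`. The latter sum is `g(J H_J, x)`, and the difference
between the two is `g(J T_J, x)`.

The first identification is `inner_meanTensor`. For vector fields `W`, `X` on `L`, the function
`g(π_L^t W, JX) = g(W, π_L JX)` vanishes identically. Differentiating it along `v` with a connection
that preserves `g` and `J` gives `0 = g(∇_v(π_L^t W), JX) + g(W, π_L J ∇_v X)`. As `J` is skew for
`g`, this says `g(π_T J ∇_v(π_L^t W), X) = g(W, B(v, X))`; now put `v = W = e_i` and sum.

The second is `maslovTensor_sub`: antisymmetrizing `∇_X Y` on `L` leaves the torsion and a bracket,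
so `B(x, e_i) - B(e_i, x) = π_L J T(x, e_i)`. The sum of the products with `e_i` is `g(J T_J, x)`,
because `J T_J` is the vector whose coefficients in the frame `e_j` are these torsion traces.

Both arguments use the pulled-back connection on fields along `ι`. Its compatibility with `g` and
`J` is reduced by `DiffAlong.induction` to restrictions of fields on `M`;
`pullbackCov_pushField_sub` obtains the torsion from the symmetry of the second derivative of `ι` in
charts. -/

namespace TotallyReal

/-! ### Compatibility of the pulled-back connection with the metric and with `J`. -/

section PullbackCompat

variable {E : Type*} [NormedAddCommGroup E] [NormedSpace ℝ E] [FiniteDimensional ℝ E]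
  {M : Type*} [TopologicalSpace M] [ChartedSpace E M] [IsManifold 𝓘(ℝ, E) ∞ M]
  {F : Type*} [NormedAddCommGroup F] [NormedSpace ℝ F] [FiniteDimensional ℝ F]
  {L : Type*} [TopologicalSpace L] [ChartedSpace F L] [IsManifold 𝓘(ℝ, F) ∞ L]

-- Locality: the definition involves only the derivative at `p` of the components and the value at
-- `p`, and both depend only on the germ.
omit [FiniteDimensional ℝ E] [FiniteDimensional ℝ F] [IsManifold 𝓘(ℝ, F) ∞ L] in
theorem pullbackCov_congr
    (cov : CovariantDerivative 𝓘(ℝ, E) E (TangentSpace 𝓘(ℝ, E) : M → Type _))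
    {ι : L → M} {p : L} {s t : ∀ q : L, TangentSpace 𝓘(ℝ, E) (ι q)}
    (h : ∀ᶠ q in 𝓝 p, s q = t q) : pullbackCov F cov ι s p = pullbackCov F cov ι t p := by
  have hc : coordAlong E ι s p =ᶠ[𝓝 p] coordAlong E ι t p := by
    filter_upwards [h] with q hq
    rw [coordAlong, coordAlong, hq]
  rw [pullbackCov, pullbackCov, mvfderiv_congr hc, h.self_of_nhds]

omit [FiniteDimensional ℝ F] [IsManifold 𝓘(ℝ, F) ∞ L] in
/-- A property of vector fields along `ι` that holds for restrictions of vector fields on `M` and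
is local and stable under sums and multiplication by functions holds for all differentiable vector
fields along `ι`. -/
theorem DiffAlong.induction {ι : L → M} {p : L} (hι : MDifferentiableAt 𝓘(ℝ, F) 𝓘(ℝ, E) ι p)
    {P : (∀ q : L, TangentSpace 𝓘(ℝ, E) (ι q)) → Prop}
    (comp : ∀ σ : ∀ x : M, TangentSpace 𝓘(ℝ, E) x,
      MDifferentiableAt 𝓘(ℝ, E) (𝓘(ℝ, E).prod 𝓘(ℝ, E)) (fun x ↦
        (TotalSpace.mk' E x (σ x) : TotalSpace E (TangentSpace 𝓘(ℝ, E) : M → Type _))) (ι p) →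
      P fun q ↦ σ (ι q))
    (add : ∀ s t, DiffAlong E F ι s p → DiffAlong E F ι t p → P s → P t → P fun q ↦ s q + t q)
    (smul : ∀ (f : L → ℝ) s, MDifferentiableAt 𝓘(ℝ, F) 𝓘(ℝ, ℝ) f p → DiffAlong E F ι s p → P s →
      P fun q ↦ f q • s q)
    (congr : ∀ s t, DiffAlong E F ι s p → (∀ᶠ q in 𝓝 p, t q = s q) → P s → P t)
    {s : ∀ q : L, TangentSpace 𝓘(ℝ, E) (ι q)} (hs : DiffAlong E F ι s p) : P s := by
  classical
  let e := trivializationAt E (TangentSpace 𝓘(ℝ, E) : M → Type _) (ι p)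
  have hx : ι p ∈ e.baseSet := FiberBundle.mem_baseSet_trivializationAt' (ι p)
  let b : Basis (Fin (finrank ℝ E)) ℝ E := finBasis ℝ E
  -- The fields `σ i` form the coordinate frame around `ι p`. Near `p` the field `s` is `∑ c i • (σ
  -- i ∘ ι)`, with coefficients that are functions on `L`, so the hypotheses on `P` apply term by
  -- term.
  let σ : Fin (finrank ℝ E) → ∀ x : M, TangentSpace 𝓘(ℝ, E) x := fun i ↦
    FiberBundle.extend E (e.symm (ι p) (b i))
  have hσ : ∀ i, MDifferentiableAt 𝓘(ℝ, E) (𝓘(ℝ, E).prod 𝓘(ℝ, E)) (fun x ↦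
      (TotalSpace.mk' E x (σ i x) : TotalSpace E (TangentSpace 𝓘(ℝ, E) : M → Type _))) (ι p) :=
    fun i ↦ FiberBundle.mdifferentiableAt_extend ..
  have hσd : ∀ i, DiffAlong E F ι (fun q ↦ σ i (ι q)) p := fun i ↦ (hσ i).comp p hι
  have hσe : ∀ i y, y ∈ e.baseSet → σ i y = e.symm y (b i) := by
    intro i y hy
    change e.symm y (e ⟨ι p, e.symm (ι p) (b i)⟩).2 = _
    rw [e.apply_mk_symm hx]
  have hc : MDifferentiableAt 𝓘(ℝ, F) 𝓘(ℝ, E) (coordAlong E ι s p) p := (diffAlong_iff hι s).1 hs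
  let c : Fin (finrank ℝ E) → L → ℝ := fun i q ↦ b.coord i (coordAlong E ι s p q)
  have hcd : ∀ i, MDifferentiableAt 𝓘(ℝ, F) 𝓘(ℝ, ℝ) (c i) p := fun i ↦
    (LinearMap.toContinuousLinearMap (b.coord i)).mdifferentiableAt.comp p hc
  have key : ∀ S : Finset (Fin (finrank ℝ E)),
      DiffAlong E F ι (fun q ↦ ∑ i ∈ S, c i q • σ i (ι q)) p ∧
        P fun q ↦ ∑ i ∈ S, c i q • σ i (ι q) := by
    intro S
    induction S using Finset.induction_on with
    | empty =>
      simp only [Finset.sum_empty]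
      -- The zero field along `ι` is the restriction of the zero section, so `comp` also covers the
      -- empty sum.
      have h0 : MDifferentiableAt 𝓘(ℝ, E) (𝓘(ℝ, E).prod 𝓘(ℝ, E)) (fun x ↦
          (TotalSpace.mk' E x (0 : TangentSpace 𝓘(ℝ, E) x) :
            TotalSpace E (TangentSpace 𝓘(ℝ, E) : M → Type _))) (ι p) :=
        mdifferentiable_zeroSection ℝ (TangentSpace 𝓘(ℝ, E) : M → Type _) (ι p)
      exact ⟨h0.comp p hι, comp (fun _ ↦ 0) h0⟩
    | insert a S ha ih =>
      simp only [Finset.sum_insert ha]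
      have h1 := (hσd a).smul hι (hcd a)
      exact ⟨h1.add hι ih.1, add _ _ h1 ih.1 (smul _ _ (hcd a) (hσd a) (comp _ (hσ a))) ih.2⟩
  refine congr _ _ (key Finset.univ).1 ?_ (key Finset.univ).2
  filter_upwards [eventually_baseSet (E := E) hι.continuousAt] with q hq
  have h1 : ∑ i, c i q • b i = coordAlong E ι s p q := b.sum_repr _
  have h2 : e.symm (ι q) (coordAlong E ι s p q) = s q := e.symm_apply_apply_mk hq (s q)
  rw [← h2, ← h1, ← e.symmₗ_apply (R := ℝ) hq, map_sum]
  refine Finset.sum_congr rfl fun i _ ↦ ?_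
  rw [map_smul, e.symmₗ_apply (R := ℝ) hq, hσe i _ hq]

/-- The pull-back of a connection preserving `J` preserves `J`. -/
theorem IsUnitaryConnection.pullbackCov_rotate {g : Metric E M} {J : AlmostComplexStructure E M}
    {cov : CovariantDerivative 𝓘(ℝ, E) E (TangentSpace 𝓘(ℝ, E) : M → Type _)}
    (hcov : IsUnitaryConnection g J cov) {ι : L → M} {p : L}
    (hι : MDifferentiableAt 𝓘(ℝ, F) 𝓘(ℝ, E) ι p)
    {s : ∀ q : L, TangentSpace 𝓘(ℝ, E) (ι q)} (hs : DiffAlong E F ι s p)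
    (v : TangentSpace 𝓘(ℝ, F) p) :
    pullbackCov F cov ι (fun q ↦ J (ι q) (s q)) p v = J (ι p) (pullbackCov F cov ι s p v) := by
  refine DiffAlong.induction hι (P := fun s ↦ pullbackCov F cov ι (fun q ↦ J (ι q) (s q)) p v =
    J (ι p) (pullbackCov F cov ι s p v)) (fun σ hσ ↦ ?_) (fun s t hs ht ihs iht ↦ ?_)
    (fun f s hf hs ih ↦ ?_) (fun s t _ h ih ↦ ?_) hs
  · have hJσ : MDifferentiableAt 𝓘(ℝ, E) (𝓘(ℝ, E).prod 𝓘(ℝ, E)) (fun x ↦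
        (TotalSpace.mk' E x (J x (σ x)) :
          TotalSpace E (TangentSpace 𝓘(ℝ, E) : M → Type _))) (ι p) :=
      DiffAlong.rotate (ι := fun x : M ↦ x) mdifferentiableAt_id hσ
    rw [pullbackCov_comp cov hι hJσ, pullbackCov_comp cov hι hσ, hcov.complex _ _ hσ]
  · simp only [map_add]
    rw [pullbackCov_add cov hι (hs.rotate hι) (ht.rotate hι), pullbackCov_add cov hι hs ht]
    simp [ihs, iht]
  -- The derivative of the coefficient contributes `df(v) • J s` on both sides, since `J` is linear
  -- on each fibre.
  · simp only [map_smul]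
    rw [pullbackCov_smul cov hι hf (hs.rotate hι), pullbackCov_smul cov hι hf hs, ih]
    simp
  · rw [pullbackCov_congr cov h, ← ih]
    refine DFunLike.congr_fun (pullbackCov_congr cov ?_) v
    filter_upwards [h] with q hq
    rw [hq]

/-- The Leibniz rule for `ι^*∇` and the metric when one of the two fields along `ι` is the
restriction of a vector field on `M`. -/
theorem IsUnitaryConnection.mvfderiv_inner_comp {g : Metric E M} {J : AlmostComplexStructure E M}
    {cov : CovariantDerivative 𝓘(ℝ, E) E (TangentSpace 𝓘(ℝ, E) : M → Type _)}
    (hcov : IsUnitaryConnection g J cov) {ι : L → M} {p : L}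
    (hι : MDifferentiableAt 𝓘(ℝ, F) 𝓘(ℝ, E) ι p) {σ : ∀ x : M, TangentSpace 𝓘(ℝ, E) x}
    (hσ : MDifferentiableAt 𝓘(ℝ, E) (𝓘(ℝ, E).prod 𝓘(ℝ, E)) (fun x ↦
      (TotalSpace.mk' E x (σ x) : TotalSpace E (TangentSpace 𝓘(ℝ, E) : M → Type _))) (ι p))
    {t : ∀ q : L, TangentSpace 𝓘(ℝ, E) (ι q)} (ht : DiffAlong E F ι t p)
    (v : TangentSpace 𝓘(ℝ, F) p) :
    mvfderiv 𝓘(ℝ, F) (fun q ↦ g.inner (ι q) (σ (ι q)) (t q)) p v =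
      g.inner (ι p) (pullbackCov F cov ι (fun q ↦ σ (ι q)) p v) (t p) +
        g.inner (ι p) (σ (ι p)) (pullbackCov F cov ι t p v) := by
  have hσd : DiffAlong E F ι (fun q ↦ σ (ι q)) p := hσ.comp p hι
  refine DiffAlong.induction hι (P := fun t ↦
    mvfderiv 𝓘(ℝ, F) (fun q ↦ g.inner (ι q) (σ (ι q)) (t q)) p v =
      g.inner (ι p) (pullbackCov F cov ι (fun q ↦ σ (ι q)) p v) (t p) +
        g.inner (ι p) (σ (ι p)) (pullbackCov F cov ι t p v)) (fun τ hτ ↦ ?_)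
    (fun s t hs ht ihs iht ↦ ?_) (fun f s hf hs ih ↦ ?_) (fun s t _ h ih ↦ ?_) ht
  · have hd : MDifferentiableAt 𝓘(ℝ, E) 𝓘(ℝ, ℝ) (fun x ↦ g.inner x (σ x) (τ x)) (ι p) :=
      DiffAlong.inner g (ι := fun x : M ↦ x) mdifferentiableAt_id hσ hτ
    have h1 := mvfderiv_comp_vec hd hι v
    -- With both fields restricted from `M`, the claim is the chain rule followed by the Leibniz
    -- rule on `M` in the direction `dι v`.
    rw [hcov.metric _ _ _ hσ hτ] at h1
    rw [pullbackCov_comp cov hι hσ, pullbackCov_comp cov hι hτ]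
    exact h1
  · have h1 := mvfderiv_add (hσd.inner g hι hs) (hσd.inner g hι ht)
    simp only [map_add]
    rw [pullbackCov_add cov hι hs ht]
    refine (DFunLike.congr_fun h1 v).trans ?_
    simp only [add_apply, map_add, ihs, iht]
    ring
  · have h1 := mvfderiv_smul hf (hσd.inner g hι hs)
    simp only [map_smul]
    rw [pullbackCov_smul cov hι hf hs]
    refine (DFunLike.congr_fun h1 v).trans ?_
    simp [ih]
    ring
  · rw [pullbackCov_congr cov h, h.self_of_nhds, ← ih]
    refine DFunLike.congr_fun (mvfderiv_congr ?_) v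
    filter_upwards [h] with q hq
    rw [hq]

/-- The pull-back of a metric connection is metric. -/
theorem IsUnitaryConnection.mvfderiv_inner {g : Metric E M} {J : AlmostComplexStructure E M}
    {cov : CovariantDerivative 𝓘(ℝ, E) E (TangentSpace 𝓘(ℝ, E) : M → Type _)}
    (hcov : IsUnitaryConnection g J cov) {ι : L → M} {p : L}
    (hι : MDifferentiableAt 𝓘(ℝ, F) 𝓘(ℝ, E) ι p)
    {s t : ∀ q : L, TangentSpace 𝓘(ℝ, E) (ι q)} (hs : DiffAlong E F ι s p)
    (ht : DiffAlong E F ι t p) (v : TangentSpace 𝓘(ℝ, F) p) :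
    mvfderiv 𝓘(ℝ, F) (fun q ↦ g.inner (ι q) (s q) (t q)) p v =
      g.inner (ι p) (pullbackCov F cov ι s p v) (t p) +
        g.inner (ι p) (s p) (pullbackCov F cov ι t p v) := by
  -- A second induction, now in the first argument with `t` arbitrary; `mvfderiv_inner_comp` has
  -- already freed the second argument and serves as the base case.
  refine DiffAlong.induction hι (P := fun s ↦
    mvfderiv 𝓘(ℝ, F) (fun q ↦ g.inner (ι q) (s q) (t q)) p v =
      g.inner (ι p) (pullbackCov F cov ι s p v) (t p) +
        g.inner (ι p) (s p) (pullbackCov F cov ι t p v))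
    (fun σ hσ ↦ hcov.mvfderiv_inner_comp hι hσ ht v)
    (fun s s' hs hs' ihs ihs' ↦ ?_) (fun f s hf hs ih ↦ ?_) (fun s s' _ h ih ↦ ?_) hs
  · have h1 := mvfderiv_add (hs.inner g hι ht) (hs'.inner g hι ht)
    simp only [map_add, add_apply]
    rw [pullbackCov_add cov hι hs hs']
    refine (DFunLike.congr_fun h1 v).trans ?_
    simp only [add_apply, map_add, ihs, ihs']
    ring
  · have h1 := mvfderiv_smul hf (hs.inner g hι ht)
    simp only [map_smul, smul_apply]
    rw [pullbackCov_smul cov hι hf hs]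
    refine (DFunLike.congr_fun h1 v).trans ?_
    simp [ih]
    ring
  · rw [pullbackCov_congr cov h, h.self_of_nhds, ← ih]
    refine DFunLike.congr_fun (mvfderiv_congr ?_) v
    filter_upwards [h] with q hq
    rw [hq]

end PullbackCompat

/-! ### Torsion along an immersion, computed with coordinate vector fields. -/

section Torsion

variable {E : Type*} [NormedAddCommGroup E] [NormedSpace ℝ E]
  {M : Type*} [TopologicalSpace M] [ChartedSpace E M] [IsManifold 𝓘(ℝ, E) ∞ M]
  {F : Type*} [NormedAddCommGroup F] [NormedSpace ℝ F]
  {L : Type*} [TopologicalSpace L] [ChartedSpace F L] [IsManifold 𝓘(ℝ, F) ∞ L]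

/-- Coordinate vector fields are constant in the chart. -/
theorem extend_eq_mfderiv_symm {x y : M} (v : TangentSpace 𝓘(ℝ, E) x)
    (hy : y ∈ (chartAt E x).source) :
    (FiberBundle.extend E v : ∀ y : M, TangentSpace 𝓘(ℝ, E) y) y =
      mfderivWithin 𝓘(ℝ, E) 𝓘(ℝ, E) (extChartAt 𝓘(ℝ, E) x).symm (Set.range 𝓘(ℝ, E))
        (extChartAt 𝓘(ℝ, E) x y) v := by
  let e := trivializationAt E (TangentSpace 𝓘(ℝ, E) : M → Type _) x
  have hx : x ∈ e.baseSet := FiberBundle.mem_baseSet_trivializationAt' x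
  -- The fibre at `x` is identified with `E` by the preferred chart at `x`, so the trivialization
  -- centred at `x` is the identity on that fibre.
  have hv : (e ⟨x, v⟩).2 = v := by
    have h1 : e.continuousLinearMapAt ℝ x v = (e ⟨x, v⟩).2 :=
      congrFun (e.coe_linearMapAt_of_mem (R := ℝ) hx) v
    rw [← h1, TangentBundle.continuousLinearMapAt_trivializationAt (mem_chart_source E x),
      mfderiv_extChartAt_self]
    rfl
  have hye : y ∈ e.baseSet := hy
  have h2 : (FiberBundle.extend E v : ∀ y : M, TangentSpace 𝓘(ℝ, E) y) y =
      e.symmL ℝ y (v : E) :=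
    (congrArg (e.symm y) hv).trans (e.symmL_apply (R := ℝ) hye (v : E)).symm
  have h3 := TangentBundle.symmL_trivializationAt (I := 𝓘(ℝ, E)) hy
  exact h2.trans (congrArg (fun A : E →L[ℝ] E ↦ A v) h3)

/-- Coordinate fields commute: pulled back by the inverse chart, both become constant. -/
theorem mlieBracket_extend {x : M} (v w : TangentSpace 𝓘(ℝ, E) x) :
    VectorField.mlieBracket 𝓘(ℝ, E) (FiberBundle.extend E v) (FiberBundle.extend E w) x = 0 := by
  have key : ∀ u : TangentSpace 𝓘(ℝ, E) x,
      VectorField.mpullbackWithin 𝓘(ℝ, E) 𝓘(ℝ, E) (extChartAt 𝓘(ℝ, E) x).symm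
        (FiberBundle.extend E u) (Set.range 𝓘(ℝ, E)) =ᶠ[𝓝 (extChartAt 𝓘(ℝ, E) x x)]
      fun _ ↦ (u : E) := by
    intro u
    filter_upwards [extChartAt_target_mem_nhds (I := 𝓘(ℝ, E)) x] with z hz
    have hy : (extChartAt 𝓘(ℝ, E) x).symm z ∈ (chartAt E x).source := by
      rw [← extChartAt_source 𝓘(ℝ, E)]
      exact (extChartAt 𝓘(ℝ, E) x).map_target hz
    rw [VectorField.mpullbackWithin_apply, extend_eq_mfderiv_symm u hy,
      (extChartAt 𝓘(ℝ, E) x).right_inv hz]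
    exact (isInvertible_mfderivWithin_extChartAt_symm hz).inverse_apply_self _
  have hc : ∀ (a b z : E) (S : Set E),
      VectorField.lieBracketWithin ℝ (fun _ : E ↦ a) (fun _ : E ↦ b) S z = 0 :=
    fun a b z S ↦ by simp [VectorField.lieBracketWithin]
  rw [VectorField.mlieBracket, VectorField.mlieBracketWithin_apply,
    Filter.EventuallyEq.lieBracketWithin_vectorField_eq ((key v).filter_mono nhdsWithin_le_nhds)
      (key v).self_of_nhds ((key w).filter_mono nhdsWithin_le_nhds) (key w).self_of_nhds]
  exact (congrArg _ (hc _ _ _ _)).trans (map_zero _)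

/-- Torsion is tensorial, so it may be evaluated on coordinate fields, whose bracket vanishes. -/
theorem torsion_eq_extend [FiniteDimensional ℝ E]
    (cov : CovariantDerivative 𝓘(ℝ, E) E (TangentSpace 𝓘(ℝ, E) : M → Type _))
    {x : M} (v w : TangentSpace 𝓘(ℝ, E) x) :
    cov.torsion x v w = cov (FiberBundle.extend E w) x v - cov (FiberBundle.extend E v) x w := by
  rw [cov.torsion_apply_eq_extend, mlieBracket_extend, sub_zero, extend_self, extend_self]

/-- The chain rule in charts. It makes the derivative of the components of `dι(W)` a second
derivative of the coordinate expression of `ι`. -/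
theorem coordAlong_pushField_extend {ι : L → M} (hι : ContMDiff 𝓘(ℝ, F) 𝓘(ℝ, E) ∞ ι) (p : L)
    (w : TangentSpace 𝓘(ℝ, F) p) :
    coordAlong E ι (pushField E ι (FiberBundle.extend F w)) p =ᶠ[𝓝 p]
      (fun z ↦ fderiv ℝ (writtenInExtChartAt 𝓘(ℝ, F) 𝓘(ℝ, E) p ι) z (w : F)) ∘
        extChartAt 𝓘(ℝ, F) p := by
  filter_upwards [(chartAt F p).open_source.mem_nhds (mem_chart_source F p),
    hι.continuous.continuousAt.preimage_mem_nhds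
      ((chartAt E (ι p)).open_source.mem_nhds (mem_chart_source E (ι p)))] with q hq hq'
  let e := trivializationAt E (TangentSpace 𝓘(ℝ, E) : M → Type _) (ι p)
  have hqe : ι q ∈ e.baseSet := hq'
  have hqs : q ∈ (extChartAt 𝓘(ℝ, F) p).source := by rwa [extChartAt_source]
  have hqt := (extChartAt 𝓘(ℝ, F) p).map_source hqs
  have hinv := (extChartAt 𝓘(ℝ, F) p).left_inv hqs
  have h1 : coordAlong E ι (pushField E ι (FiberBundle.extend F w)) p q =
      mfderiv 𝓘(ℝ, E) 𝓘(ℝ, E) (extChartAt 𝓘(ℝ, E) (ι p)) (ι q)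
        (mfderiv 𝓘(ℝ, F) 𝓘(ℝ, E) ι q ((FiberBundle.extend F w :
          ∀ y : L, TangentSpace 𝓘(ℝ, F) y) q)) := by
    rw [← TangentBundle.continuousLinearMapAt_trivializationAt hq']
    exact (congrFun (e.coe_linearMapAt_of_mem (R := ℝ) hqe) _).symm
  have hs : MDifferentiableAt 𝓘(ℝ, F) 𝓘(ℝ, F) (extChartAt 𝓘(ℝ, F) p).symm
      (extChartAt 𝓘(ℝ, F) p q) := by
    have := mdifferentiableWithinAt_extChartAt_symm hqt
    rwa [modelWithCornersSelf_coe, Set.range_id, mdifferentiableWithinAt_univ] at this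
  -- The model has no boundary, so `Set.range 𝓘(ℝ, F)` is the whole space; the derivative is written
  -- within it to match `extend_eq_mfderiv_symm`.
  have hc1 : HasMFDerivAt 𝓘(ℝ, F) 𝓘(ℝ, F) (extChartAt 𝓘(ℝ, F) p).symm (extChartAt 𝓘(ℝ, F) p q)
      (mfderivWithin 𝓘(ℝ, F) 𝓘(ℝ, F) (extChartAt 𝓘(ℝ, F) p).symm (Set.range 𝓘(ℝ, F))
        (extChartAt 𝓘(ℝ, F) p q)) := by
    have := hs.hasMFDerivAt
    rwa [← mfderivWithin_univ, ← Set.range_id, ← modelWithCornersSelf_coe ℝ F] at this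
  have hc2 : HasMFDerivAt 𝓘(ℝ, F) 𝓘(ℝ, E) ι
      ((extChartAt 𝓘(ℝ, F) p).symm (extChartAt 𝓘(ℝ, F) p q)) (mfderiv 𝓘(ℝ, F) 𝓘(ℝ, E) ι q) := by
    rw [hinv]
    exact ((hι q).mdifferentiableAt (by simp)).hasMFDerivAt
  have hc3 : HasMFDerivAt 𝓘(ℝ, E) 𝓘(ℝ, E) (extChartAt 𝓘(ℝ, E) (ι p))
      (ι ((extChartAt 𝓘(ℝ, F) p).symm (extChartAt 𝓘(ℝ, F) p q)))
      (mfderiv 𝓘(ℝ, E) 𝓘(ℝ, E) (extChartAt 𝓘(ℝ, E) (ι p)) (ι q)) := by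
    rw [hinv]
    exact (mdifferentiableAt_extChartAt hq').hasMFDerivAt
  have hc4 := hc3.comp (extChartAt 𝓘(ℝ, F) p q) (hc2.comp (extChartAt 𝓘(ℝ, F) p q) hc1)
  have hc5 := hc4.mfderiv
  rw [mfderiv_eq_fderiv] at hc5
  rw [h1, extend_eq_mfderiv_symm w hq]
  exact (congrArg (fun A : F →L[ℝ] E ↦ A w) hc5).symm

theorem fderiv_clm_apply_const {V W : Type*} [NormedAddCommGroup V] [NormedSpace ℝ V]
    [NormedAddCommGroup W] [NormedSpace ℝ W] {Φ : V → V →L[ℝ] W} {x : V}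
    (h : DifferentiableAt ℝ Φ x) (a b : V) :
    fderiv ℝ (fun z ↦ Φ z a) x b = fderiv ℝ Φ x b a := by
  rw [fderiv_clm_apply h (differentiableAt_const a)]
  simp

/-- For coordinate vector fields `V`, `W` on `L` with values `v`, `w` at `p`, the difference
`∇_V W - ∇_W V` at `p` is the torsion `T(v, w)`. -/
theorem pullbackCov_pushField_sub [FiniteDimensional ℝ E]
    (cov : CovariantDerivative 𝓘(ℝ, E) E (TangentSpace 𝓘(ℝ, E) : M → Type _))
    {ι : L → M} (hι : ContMDiff 𝓘(ℝ, F) 𝓘(ℝ, E) ∞ ι) (p : L) (v w : TangentSpace 𝓘(ℝ, F) p) :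
    pullbackCov F cov ι (pushField E ι (FiberBundle.extend F w)) p v -
        pullbackCov F cov ι (pushField E ι (FiberBundle.extend F v)) p w =
      cov.torsion (ι p) (mfderiv 𝓘(ℝ, F) 𝓘(ℝ, E) ι p v) (mfderiv 𝓘(ℝ, F) 𝓘(ℝ, E) ι p w) := by
  have hcd : ContDiffAt ℝ 2 (writtenInExtChartAt 𝓘(ℝ, F) 𝓘(ℝ, E) p ι) (extChartAt 𝓘(ℝ, F) p p) := by
    have := ((contMDiffAt_iff ..).1 (hι p)).2
    simp only [modelWithCornersSelf_coe, Set.range_id, contDiffWithinAt_univ] at this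
    exact this.of_le (WithTop.coe_le_coe.2 (show (2 : ℕ∞) ≤ ⊤ from le_top))
  have hsymm := hcd.isSymmSndFDerivAt (by simp)
  have hderiv : ∀ a b : TangentSpace 𝓘(ℝ, F) p,
      mvfderiv 𝓘(ℝ, F) (coordAlong E ι (pushField E ι (FiberBundle.extend F a)) p) p b =
        fderiv ℝ (fderiv ℝ (writtenInExtChartAt 𝓘(ℝ, F) 𝓘(ℝ, E) p ι)) (extChartAt 𝓘(ℝ, F) p p)
          (b : F) (a : F) := by
    intro a b
    have h1 : DifferentiableAt ℝ (fderiv ℝ (writtenInExtChartAt 𝓘(ℝ, F) 𝓘(ℝ, E) p ι))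
        (extChartAt 𝓘(ℝ, F) p p) :=
      (hcd.fderiv_right (m := 1) (by norm_num)).differentiableAt (by simp)
    have h2 : DifferentiableAt ℝ
        (fun z ↦ fderiv ℝ (writtenInExtChartAt 𝓘(ℝ, F) 𝓘(ℝ, E) p ι) z (a : F))
        (extChartAt 𝓘(ℝ, F) p p) := h1.clm_apply (differentiableAt_const _)
    have h3 : mvfderiv 𝓘(ℝ, F)
        (fun z ↦ fderiv ℝ (writtenInExtChartAt 𝓘(ℝ, F) 𝓘(ℝ, E) p ι) z (a : F))
        (extChartAt 𝓘(ℝ, F) p p) (b : F) =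
          fderiv ℝ (fderiv ℝ (writtenInExtChartAt 𝓘(ℝ, F) 𝓘(ℝ, E) p ι)) (extChartAt 𝓘(ℝ, F) p p)
            (b : F) (a : F) := by
      rw [mvfderiv, mfderiv_eq_fderiv]
      exact fderiv_clm_apply_const h1 a b
    rw [mvfderiv_congr (coordAlong_pushField_extend hι p a),
      mvfderiv_comp_vec h2.mdifferentiableAt (mdifferentiableAt_extChartAt (mem_chart_source F p)),
      mfderiv_extChartAt_self]
    exact h3
  have hp : ∀ a, pushField E ι (FiberBundle.extend F a) p = mfderiv 𝓘(ℝ, F) 𝓘(ℝ, E) ι p a := by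
    intro a
    rw [pushField, extend_self]
  simp only [pullbackCov, add_apply, ContinuousLinearMap.comp_apply]
  -- The second derivatives cancel by symmetry. What remains is the difference of the two connection
  -- terms on coordinate fields of `M`, which is the torsion.
  rw [hderiv, hderiv, show _ = _ from hsymm v w, hp, hp, torsion_eq_extend]
  abel

end Torsion

/-! ### Traces, the transpose identity, and the comparison with `H_J` and `T_J`. -/

section MaslovForm

variable {E : Type*} [NormedAddCommGroup E] [NormedSpace ℝ E] [FiniteDimensional ℝ E]
  {M : Type*} [TopologicalSpace M] [ChartedSpace E M] [IsManifold 𝓘(ℝ, E) ∞ M]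
  {F : Type*} [NormedAddCommGroup F] [NormedSpace ℝ F] [FiniteDimensional ℝ F]
  {L : Type*} [TopologicalSpace L] [ChartedSpace F L] [IsManifold 𝓘(ℝ, F) ∞ L]
  {J : AlmostComplexStructure E M} {ι : L → M}

/-- `J π_J = π_L J`. -/
theorem J_projJ (h : IsTotallyReal F J ι) (p : L) (v : TangentSpace 𝓘(ℝ, E) (ι p)) :
    J (ι p) (projJ h p v) = projL h p (J (ι p) v) := by
  -- With `v = a + J c` and `a`, `c` tangent, both sides equal `-c`.
  obtain ⟨a, ha, b, hb, rfl⟩ := Submodule.mem_sup.1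
    ((h.isCompl p).sup_eq_top ▸ Submodule.mem_top : v ∈ _ ⊔ _)
  obtain ⟨c, hc, rfl⟩ := hb
  have hJc : J (ι p) c ∈ rotatedPlane F J ι p := J_mem hc
  have h1 : projJ h p (J (ι p) c) = J (ι p) c := Submodule.projection_apply_of_mem_left _ hJc
  change J (ι p) (projJ h p (a + J (ι p) c)) = projL h p (J (ι p) (a + J (ι p) c))
  rw [map_add, projJ_tangent h ha, zero_add, h1, J.sq, map_add, J.sq, map_add,
    projL_rotated h (J_mem ha), zero_add, projL_tangent h (Submodule.neg_mem _ hc)]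

omit [FiniteDimensional ℝ E] in
theorem IsAlmostHermitian.inner_J_left {g : Metric E M} (hg : IsAlmostHermitian g J) {x : M}
    (u v : TangentSpace 𝓘(ℝ, E) x) : g.inner x (J x u) v = -g.inner x u (J x v) := by
  rw [← hg x (J x u) v, J.sq, map_neg]
  rfl

omit [FiniteDimensional ℝ F] [IsManifold 𝓘(ℝ, F) ∞ L] in
/-- The orthogonal projection onto the tangent plane does not change inner products with tangent
vectors. -/
theorem inner_projT (g : Metric E M) (ι : L → M) (p : L) (u : TangentSpace 𝓘(ℝ, E) (ι p))
    {v : TangentSpace 𝓘(ℝ, E) (ι p)} (hv : v ∈ tangentPlane E F ι p) :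
    g.inner (ι p) (projT F g ι p u) v = g.inner (ι p) u v := by
  obtain ⟨a, ha, b, hb, rfl⟩ := Submodule.mem_sup.1
    ((isCompl_orthogonal g (ι p) (tangentPlane E F ι p)).sup_eq_top ▸ Submodule.mem_top :
      u ∈ _ ⊔ _)
  have h1 : projT F g ι p a = a := Submodule.projection_apply_of_mem_left _ ha
  have h2 : projT F g ι p b = 0 := (Submodule.projection_apply_eq_zero_iff _).2 hb
  have h3 : g.inner (ι p) b v = 0 := (g.symm _ _ _).trans (hb v hv)
  rw [map_add, h1, h2, add_zero, map_add, add_apply, h3, add_zero]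

omit [FiniteDimensional ℝ F] [IsManifold 𝓘(ℝ, F) ∞ L] in
theorem projT_mem (g : Metric E M) (ι : L → M) (p : L) (u : TangentSpace 𝓘(ℝ, E) (ι p)) :
    projT F g ι p u ∈ tangentPlane E F ι p :=
  Submodule.projection_apply_mem _ _

theorem mfderiv_maslovEndomorphism
    (cov : CovariantDerivative 𝓘(ℝ, E) E (TangentSpace 𝓘(ℝ, E) : M → Type _))
    (h : IsTotallyReal F J ι) (p : L) (X Y : TangentSpace 𝓘(ℝ, F) p) :
    mfderiv 𝓘(ℝ, F) 𝓘(ℝ, E) ι p (maslovEndomorphism cov h p X Y) = maslovTensor cov h p X Y :=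
  congrArg Subtype.val ((tangentEquiv h p).apply_symm_apply
    ⟨maslovTensor cov h p X Y, maslovTensor_mem cov h p X Y⟩)

/-- In an orthonormal basis the coordinates of a vector are its inner products with the basis
vectors, so these sums are the diagonal of the matrix of `A`. -/
theorem IsOrthonormal.trace_eq {g : Metric E M} {p : L}
    {e : Basis (Fin (finrank ℝ F)) ℝ (TangentSpace 𝓘(ℝ, F) p)} (he : IsOrthonormal g ι p e)
    (A : TangentSpace 𝓘(ℝ, F) p →ₗ[ℝ] TangentSpace 𝓘(ℝ, F) p) :
    LinearMap.trace ℝ _ A = ∑ i, inducedForm F g ι p (A (e i)) (e i) := by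
  have hr : ∀ (v : TangentSpace 𝓘(ℝ, F) p) i, e.repr v i = inducedForm F g ι p v (e i) := by
    intro v i
    conv_lhs => rw [← he.sum_smul v]
    simp [Finsupp.single_apply]
  rw [LinearMap.trace_eq_matrix_trace ℝ e, Matrix.trace]
  exact Finset.sum_congr rfl fun i _ ↦ by
    rw [Matrix.diag_apply, LinearMap.toMatrix_apply, hr]

theorem isOrthonormal_orthonormalBasis (g : Metric E M) (h : IsTotallyReal F J ι) (p : L) :
    IsOrthonormal g ι p (orthonormalBasis g h p) :=
  (exists_isOrthonormal g h p).choose_spec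

theorem maslovForm_eq_sum (g : Metric E M)
    (cov : CovariantDerivative 𝓘(ℝ, E) E (TangentSpace 𝓘(ℝ, E) : M → Type _))
    (h : IsTotallyReal F J ι) (p : L) (X : TangentSpace 𝓘(ℝ, F) p) :
    maslovForm cov h p X = ∑ i, g.inner (ι p)
      (maslovTensor cov h p X (orthonormalBasis g h p i)) (orthonormalFrame g h p i) := by
  refine ((isOrthonormal_orthonormalBasis g h p).trace_eq _).trans
    (Finset.sum_congr rfl fun i _ ↦ ?_)
  rw [inducedForm_apply, mfderiv_maslovEndomorphism]
  rfl

/-- `g(π_T J ∇_v (π_L^t w), x) = g(w, π_L J ∇_v x)`: the mean curvature tensor is the transpose of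
the Maslov tensor. -/
theorem inner_meanTensor {g : Metric E M} (hg : IsAlmostHermitian g J)
    {cov : CovariantDerivative 𝓘(ℝ, E) E (TangentSpace 𝓘(ℝ, E) : M → Type _)}
    (hcov : IsUnitaryConnection g J cov) (h : IsTotallyReal F J ι) (p : L)
    (v w x : TangentSpace 𝓘(ℝ, F) p) :
    g.inner (ι p) (meanTensor g hg cov h p v w) (mfderiv 𝓘(ℝ, F) 𝓘(ℝ, E) ι p x) =
      g.inner (ι p) (mfderiv 𝓘(ℝ, F) 𝓘(ℝ, E) ι p w) (maslovTensor cov h p v x) := by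
  have hι := h.mdifferentiableAt p
  let W : ∀ q : L, TangentSpace 𝓘(ℝ, F) q := FiberBundle.extend F w
  let X : ∀ q : L, TangentSpace 𝓘(ℝ, F) q := FiberBundle.extend F x
  have hW : DiffField F W p := FiberBundle.mdifferentiableAt_extend ..
  have hX : DiffField F X p := FiberBundle.mdifferentiableAt_extend ..
  have hWp : W p = w := extend_self w
  have hXp : X p = x := extend_self x
  have hXd := diffAlong_pushField h hX
  have h0 := hcov.mvfderiv_inner hι (diffAlong_projLt g h hW) (hXd.rotate (J := J) hι) v
  -- The transpose `π_L^t` takes values orthogonal to `J(TL)`, because `π_L` kills `J(TL)`.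
  have hz : (fun q ↦ g.inner (ι q) (projLt g h q (pushField E ι W q))
      (J (ι q) (pushField E ι X q))) = fun _ ↦ 0 := by
    funext q
    rw [inner_projLt, projL_rotated h (J_mem (v := pushField E ι X q) (mfderiv_mem q (X q))),
      map_zero]
  rw [hz, mvfderiv_const, hcov.pullbackCov_rotate hι hXd, inner_projLt] at h0
  -- Paired with a tangent vector, `π_T` disappears; moving `J` across `g` costs the sign that turns
  -- the goal into `h0`.
  rw [← hWp, ← hXp, meanTensor_apply g hg cov h p v hW, maslovTensor_apply cov h p v hX,
    inner_projT g ι p _ (mfderiv_mem p _), hg.inner_J_left, J_projJ]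
  change (0 : ℝ) = _ at h0
  change -g.inner (ι p) _ (J (ι p) (pushField E ι X p)) =
    g.inner (ι p) (pushField E ι W p) _
  linarith

/-- `(X, Y) ↦ J π_J ∇_X Y` is symmetric up to torsion. -/
theorem maslovTensor_sub (cov : CovariantDerivative 𝓘(ℝ, E) E (TangentSpace 𝓘(ℝ, E) : M → Type _))
    (h : IsTotallyReal F J ι) (p : L) (v w : TangentSpace 𝓘(ℝ, F) p) :
    maslovTensor cov h p v w - maslovTensor cov h p w v = projL h p (J (ι p)
      (cov.torsion (ι p) (mfderiv 𝓘(ℝ, F) 𝓘(ℝ, E) ι p v) (mfderiv 𝓘(ℝ, F) 𝓘(ℝ, E) ι p w))) := by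
  have hd : ∀ u : TangentSpace 𝓘(ℝ, F) p, DiffField F (FiberBundle.extend F u) p := fun u ↦
    FiberBundle.mdifferentiableAt_extend ..
  have h1 := maslovTensor_apply cov h p v (hd w)
  have h2 := maslovTensor_apply cov h p w (hd v)
  rw [extend_self] at h1 h2
  -- With `π_L J` in front of both terms, linearity leaves the antisymmetrized derivative of
  -- coordinate fields, which is the torsion without a bracket term.
  rw [h1, h2, J_projJ, J_projJ, ← map_sub, ← map_sub, pullbackCov_pushField_sub cov h.contMDiff]

theorem J_meanCurvatureJ (g : Metric E M) (hg : IsAlmostHermitian g J)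
    (cov : CovariantDerivative 𝓘(ℝ, E) E (TangentSpace 𝓘(ℝ, E) : M → Type _))
    (h : IsTotallyReal F J ι) (p : L) :
    J (ι p) (meanCurvatureJ g hg cov h p) =
      ∑ i, meanTensor g hg cov h p (orthonormalBasis g h p i) (orthonormalBasis g h p i) := by
  rw [meanCurvatureJ, map_neg, J.sq, neg_neg]
  rfl

/-- The sign in `T_J` cancels against `J² = -1`, leaving a combination of the tangent vectors `e_j`.
-/
theorem J_torsionVectorJ (g : Metric E M)
    (cov : CovariantDerivative 𝓘(ℝ, E) E (TangentSpace 𝓘(ℝ, E) : M → Type _))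
    (h : IsTotallyReal F J ι) (p : L) :
    J (ι p) (torsionVectorJ g cov h p) = ∑ i, ∑ j, g.inner (ι p)
      (projL h p (J (ι p)
        (cov.torsion (ι p) (orthonormalFrame g h p j) (orthonormalFrame g h p i))))
      (orthonormalFrame g h p i) • orthonormalFrame g h p j := by
  simp only [torsionVectorJ, map_neg, map_sum, map_smul, J.sq, smul_neg, Finset.sum_neg_distrib,
    neg_neg]

theorem sum_inner_smul_orthonormalFrame (g : Metric E M) (h : IsTotallyReal F J ι) (p : L)
    (x : TangentSpace 𝓘(ℝ, F) p) :
    ∑ j, g.inner (ι p) (orthonormalFrame g h p j) (mfderiv 𝓘(ℝ, F) 𝓘(ℝ, E) ι p x) •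
      orthonormalFrame g h p j = mfderiv 𝓘(ℝ, F) 𝓘(ℝ, E) ι p x := by
  conv_rhs => rw [← (isOrthonormal_orthonormalBasis g h p).sum_smul x]
  rw [map_sum]
  refine Finset.sum_congr rfl fun j _ ↦ ?_
  rw [map_smul, inducedForm_apply, g.symm]
  rfl

/-- Expanding `x` in the frame `e_j` and using that the torsion is linear in its first argument
absorbs the sum over `j`. -/
theorem inner_J_torsionVectorJ (g : Metric E M)
    (cov : CovariantDerivative 𝓘(ℝ, E) E (TangentSpace 𝓘(ℝ, E) : M → Type _))
    (h : IsTotallyReal F J ι) (p : L) (x : TangentSpace 𝓘(ℝ, F) p) :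
    g.inner (ι p) (J (ι p) (torsionVectorJ g cov h p)) (mfderiv 𝓘(ℝ, F) 𝓘(ℝ, E) ι p x) =
      ∑ i, g.inner (ι p) (projL h p (J (ι p) (cov.torsion (ι p)
        (mfderiv 𝓘(ℝ, F) 𝓘(ℝ, E) ι p x) (orthonormalFrame g h p i))))
        (orthonormalFrame g h p i) := by
  rw [J_torsionVectorJ]
  conv_rhs => rw [← sum_inner_smul_orthonormalFrame g h p x]
  simp only [map_sum, map_smul, sum_apply, smul_apply, smul_eq_mul]
  exact Finset.sum_congr rfl fun i _ ↦ Finset.sum_congr rfl fun j _ ↦ mul_comm _ _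

theorem inner_J_add_eq_maslovForm {g : Metric E M} (hg : IsAlmostHermitian g J)
    {cov : CovariantDerivative 𝓘(ℝ, E) E (TangentSpace 𝓘(ℝ, E) : M → Type _)}
    (hcov : IsUnitaryConnection g J cov) (h : IsTotallyReal F J ι) (p : L)
    (x : TangentSpace 𝓘(ℝ, F) p) :
    g.inner (ι p) (J (ι p) (meanCurvatureJ g hg cov h p) + J (ι p) (torsionVectorJ g cov h p))
      (mfderiv 𝓘(ℝ, F) 𝓘(ℝ, E) ι p x) = maslovForm cov h p x := by
  rw [maslovForm_eq_sum g, map_add, add_apply, inner_J_torsionVectorJ, J_meanCurvatureJ, map_sum,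
    sum_apply, ← Finset.sum_add_distrib]
  refine Finset.sum_congr rfl fun i _ ↦ ?_
  -- The identity holds for each `i` separately: `B(e_i, x)` comes from `H_J`, and the torsion term
  -- turns it into `B(x, e_i)`.
  have h1 := maslovTensor_sub cov h p x (orthonormalBasis g h p i)
  rw [inner_meanTensor hg hcov, g.symm, orthonormalFrame, ← h1, map_sub, sub_apply]
  ring

/-- Needed to pass from inner products with tangent vectors to an equality of vectors, since such
products determine only the tangential component. -/
theorem J_add_mem_tangentPlane {g : Metric E M} (hg : IsAlmostHermitian g J)
    (cov : CovariantDerivative 𝓘(ℝ, E) E (TangentSpace 𝓘(ℝ, E) : M → Type _))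
    (h : IsTotallyReal F J ι) (p : L) :
    J (ι p) (meanCurvatureJ g hg cov h p) + J (ι p) (torsionVectorJ g cov h p) ∈
      tangentPlane E F ι p := by
  rw [J_meanCurvatureJ, J_torsionVectorJ]
  refine Submodule.add_mem _ (Submodule.sum_mem _ fun i _ ↦ ?_)
    (Submodule.sum_mem _ fun i _ ↦ Submodule.sum_mem _ fun j _ ↦
      Submodule.smul_mem _ _ (mfderiv_mem p _))
  rw [meanTensor, TensorialAt.mkHom₂_apply_eq_extend]
  exact projT_mem g ι p _

end MaslovForm

end TotallyReal

/-- Let `(M, J, g)` be an almost Hermitian manifold with a unitary connection `cov`, and let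
`ι : L → M` be a totally real immersion. Then `ξ_J^♯ = J H_J + J T_J`; equivalently,
`ω(H_J + T_J, X) = ξ_J(X)` for all `X` tangent to `L`. -/
theorem proposition4p3
    {E : Type*} [NormedAddCommGroup E] [NormedSpace ℝ E] [FiniteDimensional ℝ E]
    {M : Type*} [TopologicalSpace M] [ChartedSpace E M] [IsManifold 𝓘(ℝ, E) ∞ M]
    {F : Type*} [NormedAddCommGroup F] [NormedSpace ℝ F] [FiniteDimensional ℝ F]
    {L : Type*} [TopologicalSpace L] [ChartedSpace F L] [IsManifold 𝓘(ℝ, F) ∞ L]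
    (g : TotallyReal.Metric E M) (J : TotallyReal.AlmostComplexStructure E M)
    (hg : TotallyReal.IsAlmostHermitian g J)
    (cov : CovariantDerivative 𝓘(ℝ, E) E (TangentSpace 𝓘(ℝ, E) : M → Type _))
    (hcov : TotallyReal.IsUnitaryConnection g J cov)
    (ι : L → M) (h : TotallyReal.IsTotallyReal F J ι) (p : L) :
    mfderiv 𝓘(ℝ, F) 𝓘(ℝ, E) ι p (TotallyReal.sharp g h p (TotallyReal.maslovForm cov h p)) =
        J (ι p) (TotallyReal.meanCurvatureJ g hg cov h p)
          + J (ι p) (TotallyReal.torsionVectorJ g cov h p) ∧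
      ∀ X : TangentSpace 𝓘(ℝ, F) p,
        TotallyReal.fundamentalForm g J (ι p)
            (TotallyReal.meanCurvatureJ g hg cov h p + TotallyReal.torsionVectorJ g cov h p)
            (mfderiv 𝓘(ℝ, F) 𝓘(ℝ, E) ι p X) =
          TotallyReal.maslovForm cov h p X := by
  have hpair := TotallyReal.inner_J_add_eq_maslovForm hg hcov h p
  refine ⟨?_, fun X ↦ ?_⟩
  · obtain ⟨u, hu⟩ := TotallyReal.J_add_mem_tangentPlane hg cov h p
    change mfderiv 𝓘(ℝ, F) 𝓘(ℝ, E) ι p u = _ at hu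
    rw [← hu, ← sub_eq_zero, ← map_sub]
    -- Both vectors are tangent to `L` and have the same inner product `ξ_J(X)` with every `X`, so
    -- nondegeneracy of the induced metric identifies them.
    have hz : ∀ X, TotallyReal.inducedForm F g ι p
        (TotallyReal.sharp g h p (TotallyReal.maslovForm cov h p) - u) X = 0 := by
      intro X
      rw [map_sub, LinearMap.sub_apply, TotallyReal.inducedForm_sharp,
        TotallyReal.inducedForm_apply, hu, hpair, sub_self]
    rw [(TotallyReal.inducedForm_nondegenerate g h p).1 _ hz, map_zero]
  · rw [TotallyReal.fundamentalForm, map_add, hpair]
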